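/- **Theorem.** For positive integers $r,p,q$ with $p\ge 3$ and $2\le q\le\binom p2$, let $F_\chi(r,p,q)$ be the minimum integer $n$ such that every edge-coloring of the complete graph $K_n$ with $r$ colors contains a subgraph of chromatic number $p$ whose edges receive at most $q-1$ distinct colors. Then, for every fixed integer $q\ge 2$, $$F_\chi(r,2^q,q+1)=2^{o(r)}\qquad (r\to\infty).$$ Moreover, for all fixed integers $p\ge 3$ and $2\le q\le\binom p2$, the function $r\mapsto F_\chi(r,p,q)$ is exponential in $r$, i.e. $F_\chi(r,p,q)=2^{\Theta(r)}$ as $r\to\infty$, if and only if $q\le\lceil\log_2 p\rceil$; and if $q>\lceil\log_2 p\rceil$, then $F_\chi(r,p,q)=2^{o(r)}$. -/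

import Mathlib

open Filter Asymptotics

/-- The number of distinct colours that the edge-colouring `c` of the complete graph `K_n`
uses on the edges of the subgraph `H`. -/
noncomputable def numColours {n r : ℕ} (c : SimpleGraph.TopEdgeLabeling (Fin n) (Fin r))
    (H : (⊤ : SimpleGraph (Fin n)).Subgraph) : ℕ :=
  (c '' {e | (e : Sym2 (Fin n)) ∈ H.edgeSet}).ncard

/-- Every edge-colouring of `K_n` with `r` colours contains a `p`-chromatic subgraph
(chromatic number equal to `p`) receiving at most `q - 1` distinct colours on its edges. -/
def ForcesChromatic (r p q n : ℕ) : Prop :=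
  ∀ c : SimpleGraph.TopEdgeLabeling (Fin n) (Fin r),
    ∃ H : (⊤ : SimpleGraph (Fin n)).Subgraph,
      H.coe.chromaticNumber = (p : ℕ∞) ∧ numColours c H ≤ q - 1

/-- The chromatic generalized Ramsey number `F_χ(r, p, q)`: the minimum `n` such that every
edge-colouring of `K_n` with `r` colours contains a `p`-chromatic subgraph receiving at most
`q - 1` distinct colours. -/
noncomputable def chromaticRamsey (r p q : ℕ) : ℕ :=
  sInf {n : ℕ | ForcesChromatic r p q n}

/-- A function `F : ℕ → ℕ` is sub-exponential: `F r = 2 ^ o(r)` as `r → ∞`. -/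
def IsSubexponential (F : ℕ → ℕ) : Prop :=
  ∃ g : ℕ → ℝ, g =o[atTop] (fun r : ℕ => (r : ℝ)) ∧ ∀ᶠ r in atTop, (F r : ℝ) = 2 ^ g r

/-- A function `F : ℕ → ℕ` is exponential: `F r = 2 ^ Θ(r)` as `r → ∞`. -/
def IsExponential (F : ℕ → ℕ) : Prop :=
  ∃ g : ℕ → ℝ, g =Θ[atTop] (fun r : ℕ => (r : ℝ)) ∧ ∀ᶠ r in atTop, (F r : ℝ) = 2 ^ g r

/-- A finite graph that cannot be properly coloured with `k` colours has an induced subgraph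
of chromatic number exactly `k + 1`. -/
theorem exists_induce_chromaticNumber_eq {V : Type*} [Finite V] (G : SimpleGraph V) (k : ℕ)
    (h : ¬ G.Colorable k) : ∃ S : Set V, (G.induce S).chromaticNumber = ((k + 1 : ℕ) : ℕ∞) := by
  classical
  have hU : ¬ (G.induce (Set.univ : Set V)).Colorable k := by
    rintro ⟨C⟩
    exact h ⟨C.comp (⟨fun v => ⟨v, trivial⟩, fun {a b} hab => hab⟩ : G →g G.induce Set.univ)⟩
  obtain ⟨S, hS⟩ := exists_minimal_of_wellFoundedLT
    (fun S : Set V => ¬ (G.induce S).Colorable k) ⟨_, hU⟩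
  refine ⟨S, le_antisymm ?_ ?_⟩
  · apply SimpleGraph.Colorable.chromaticNumber_le
    have hne : S.Nonempty := by
      rw [Set.nonempty_iff_ne_empty]
      rintro rfl
      exact hS.prop ⟨SimpleGraph.Coloring.mk (fun v => v.2.elim) (fun {v} => v.2.elim)⟩
    obtain ⟨v, hv⟩ := hne
    have hc : (G.induce (S \ {v})).Colorable k := by
      by_contra hn
      have := hS.le_of_le hn Set.sdiff_subset hv
      exact this.2 rfl
    obtain ⟨C⟩ := hc
    refine ⟨SimpleGraph.Coloring.mk
      (fun w => if hw : (w : V) = v then Fin.last k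
        else (C ⟨w, w.2, hw⟩).castSucc) ?_⟩
    intro a b hab
    by_cases ha : (a : V) = v <;> by_cases hb : (b : V) = v
    · exact absurd (Subtype.ext (ha.trans hb.symm)) hab.ne
    · simp only [ha, hb, dite_true, dite_false]
      exact (Fin.castSucc_lt_last _).ne'
    · simp only [ha, hb, dite_true, dite_false]
      exact (Fin.castSucc_lt_last _).ne
    · simp only [ha, hb, dite_false]
      intro he
      have hab' : (G.induce (S \ {v})).Adj ⟨a, a.2, ha⟩ ⟨b, b.2, hb⟩ := hab
      exact C.valid hab' (Fin.castSucc_injective _ he)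
  · by_contra hlt
    rw [not_le] at hlt
    have : (G.induce S).chromaticNumber ≤ (k : ℕ∞) := by
      have h2 : (G.induce S).chromaticNumber < (k : ℕ∞) + 1 := by exact_mod_cast hlt
      exact ENat.lt_add_one_iff (ENat.natCast_ne_top k) |>.1 h2
    exact hS.prop (SimpleGraph.chromaticNumber_le_iff_colorable.1 this)

/-- The minimum in the definition of `F_χ(r, p, q)` is taken over a non-empty set. -/
theorem exists_forcesChromatic (r p q : ℕ) (hp : 2 ≤ p) (hq : 2 ≤ q) :
    ∃ n, ForcesChromatic r p q n := by
  obtain ⟨k, rfl⟩ : ∃ k, p = k + 1 := ⟨p - 1, by omega⟩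
  refine ⟨k ^ r + 1, fun c => ?_⟩
  by_contra hno
  push Not at hno
  have hcol : ∀ i : Fin r, (c.labelGraph i).Colorable k := by
    intro i
    by_contra hi
    obtain ⟨S, hS⟩ := exists_induce_chromaticNumber_eq _ _ hi
    let H : (⊤ : SimpleGraph (Fin (k ^ r + 1))).Subgraph :=
      { verts := S
        Adj := fun a b => a ∈ S ∧ b ∈ S ∧ (c.labelGraph i).Adj a b
        adj_sub := fun h => h.2.2.ne
        edge_vert := fun h => h.1
        symm := ⟨fun _ _ h => ⟨h.2.1, h.1, h.2.2.symm⟩⟩ }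
    have hH : H.coe = (c.labelGraph i).induce S := by
      ext a b
      exact ⟨fun h => h.2.2, fun h => ⟨a.2, b.2, h⟩⟩
    have h1 : H.coe.chromaticNumber = ((k + 1 : ℕ) : ℕ∞) := by
      rw [hH]
      exact hS
    have h2 := hno H h1
    have h3 : numColours c H ≤ 1 := by
      have hsub : c '' {e | (e : Sym2 (Fin (k ^ r + 1))) ∈ H.edgeSet} ⊆ {i} := by
        rintro _ ⟨⟨e, he⟩, hmem, rfl⟩
        induction e using Sym2.ind with
        | _ a b =>
          have hab : (c.labelGraph i).Adj a b := (SimpleGraph.Subgraph.mem_edgeSet.1 hmem).2.2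
          obtain ⟨_, h⟩ := (SimpleGraph.TopEdgeLabeling.labelGraph_adj a b).1 hab
          exact h
      calc numColours c H ≤ ({i} : Set (Fin r)).ncard := Set.ncard_le_ncard hsub
        _ = 1 := Set.ncard_singleton i
    omega
  have C := fun i => (hcol i).some
  have hcard : Fintype.card (Fin r → Fin k) < Fintype.card (Fin (k ^ r + 1)) := by simp
  obtain ⟨u, v, huv, he⟩ := Fintype.exists_ne_map_eq_of_card_lt
    (fun (v : Fin (k ^ r + 1)) (i : Fin r) => C i v) hcard
  have hadj : (c.labelGraph (c.get u v huv)).Adj u v :=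
    (SimpleGraph.TopEdgeLabeling.labelGraph_adj u v).2 ⟨huv, rfl⟩
  exact (C _).valid hadj (congrFun he _)

/-- `F_χ(r, p, q)` is a genuine minimum. -/
theorem chromaticRamsey_isLeast (r p q : ℕ) (hp : 2 ≤ p) (hq : 2 ≤ q) :
    IsLeast {n : ℕ | ForcesChromatic r p q n} (chromaticRamsey r p q) :=
  ⟨Nat.sInf_mem (exists_forcesChromatic r p q hp hq), fun _ h => Nat.sInf_le h⟩

/-! Lower bound. Give the vertices distinct binary words of length `r` and colour each pair by a
coordinate where the words differ. In a subgraph with at most `q - 1` colours, restricting the words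
to those coordinates is a proper colouring, so its chromatic number is at most `2 ^ (q - 1)`. Hence
`F > 2 ^ r` when `2 ^ (q - 1) < p`, and the product bound `(p - 1) ^ r + 1` makes `F` exponential.

Upper bound. It suffices that any `r`-coloured clique on `2 ^ (ε r)` vertices has at most `i`
colours whose union is not `(2 ^ i - 1)`-colourable (`eventually_exists_not_colorable`). If a single
colour does this there is nothing to prove, so every colour class may be assumed to have bounded
chromatic number. The induction on `i` uses a robust form (`eventually_card_deficit`): for a
proportion `r ^ (-a)` of the indexed colour families, a proportion `r ^ (-a)` of any exponentially
large set must be deleted before the union becomes `(2 ^ i - 1)`-colourable.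

The doubling step is `Deficit.join`. If `X` and `Y` are both robust for `k` colours and the family
`s`, and colour `c` has edges between all large subsets of `X` and `Y`, then a colouring of almost
all of `X ∪ Y` with `2k + 1` colours has `k + 1` popular colours on each side. Some colour is
popular on both, and it is spoiled by an edge of colour `c`.

One such pair `(c, s)` is not enough to continue the induction; polynomially many in proportion are
needed. Regular pairs are therefore nested in a tree of height `L`. Both halves of a pair are
independent in its colour, so a colour occurs at most once on a branch, and `L` levels reach a
proportion of order `L / r`, up to powers of `η`. Two siblings may be robust for different `s`, but
such disagreement raises the energy `∑ s, m s ^ 2`, which is bounded (`IsProfile.node`). With `L`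
slightly below `r`, the total shrinkage of the sets is `2 ^ o(r)`. -/

open scoped Finset

/-! ### Robust non-colourability, measured by vertex deletions -/

section Deficit

variable {V K : Type*}

/-- The union of the graphs `G i`, `i ∈ S`, has a proper colouring with at most `k` colours
on the vertex set `A`. -/
def ColorableOn (G : K → SimpleGraph V) (S : Finset K) (k : ℕ) (A : Finset V) : Prop :=
  ∃ f : V → ℕ, #(A.image f) ≤ k ∧ ∀ u ∈ A, ∀ v ∈ A, ∀ i ∈ S, (G i).Adj u v → f u ≠ f v

/-- At least `x` vertices have to be deleted from `W` to make the union of the graphs `G i`,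
`i ∈ S`, properly colourable with `k` colours. -/
def Deficit (G : K → SimpleGraph V) (S : Finset K) (k : ℕ) (W : Finset V) (x : ℝ) : Prop :=
  ∀ A ⊆ W, ColorableOn G S k A → (#A : ℝ) + x ≤ #W

variable {G : K → SimpleGraph V} {S : Finset K} {k : ℕ} {A B W X Y : Finset V} {x y : ℝ}

theorem ColorableOn.mono (h : ColorableOn G S k A) (hB : B ⊆ A) : ColorableOn G S k B := by
  obtain ⟨f, hk, hf⟩ := h
  exact ⟨f, (Finset.card_le_card (Finset.image_subset_image hB)).trans hk,
    fun u hu v hv => hf u (hB hu) v (hB hv)⟩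

theorem deficit_zero : Deficit G S k W 0 := fun A hA _ => by
  rw [add_zero]; exact_mod_cast Finset.card_le_card hA

theorem Deficit.anti (h : Deficit G S k W x) (hy : y ≤ x) : Deficit G S k W y :=
  fun A hA hc => (by linarith [h A hA hc])

/-- A colouring of part of the union restricts to both pieces. This additivity is why deletions are
counted: the chromatic number itself does not accumulate over disjoint sets. -/
theorem Deficit.add [DecidableEq V] (hX : Deficit G S k X x) (hY : Deficit G S k Y y)
    (hXY : Disjoint X Y) : Deficit G S k (X ∪ Y) (x + y) := by
  intro A hA hc
  have h1 := hX (A ∩ X) Finset.inter_subset_right (hc.mono Finset.inter_subset_left)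
  have h2 := hY (A ∩ Y) Finset.inter_subset_right (hc.mono Finset.inter_subset_left)
  have h3 : #A ≤ #(A ∩ X) + #(A ∩ Y) := by
    calc #A = #(A ∩ (X ∪ Y)) := by rw [Finset.inter_eq_left.2 hA]
      _ ≤ _ := by rw [Finset.inter_union_distrib_left]; exact Finset.card_union_le _ _
  have h4 : #(X ∪ Y) = #X + #Y := Finset.card_union_of_disjoint hXY
  rw [h4]
  have h3' : (#A : ℝ) ≤ #(A ∩ X) + #(A ∩ Y) := by exact_mod_cast h3
  push_cast
  linarith

theorem Deficit.mono [DecidableEq V] (h : Deficit G S k A x) (hA : A ⊆ W) :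
    Deficit G S k W x := by
  have := h.add (deficit_zero (G := G) (S := S) (k := k) (W := W \ A)) Finset.disjoint_sdiff
  rwa [add_zero, Finset.union_sdiff_of_subset hA] at this

/-- A proper colouring of almost all of a set of large deficit has many popular colours. -/
theorem Deficit.le_card_popular {ρ τ : ℝ} {n : ℕ} (hX : Deficit G S k X (ρ * #X))
    (hA : A ⊆ X) (f : V → ℕ) {I : Finset ℕ} (hI : ∀ u ∈ A, f u ∈ I) (hn : #I ≤ n)
    (hτ : 0 ≤ τ)
    (hf : ∀ u ∈ A, ∀ v ∈ A, ∀ i ∈ S, (G i).Adj u v → f u ≠ f v)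
    (hlarge : (#X : ℝ) - ρ * #X + n * τ < #A) :
    k + 1 ≤ #{j ∈ I | τ ≤ #{u ∈ A | f u = j}} := by
  classical
  by_contra hcon
  set P : Finset ℕ := {j ∈ I | τ ≤ #{u ∈ A | f u = j}} with hP
  -- With at most `k` popular colours, their vertices form a `k`-coloured set, which misses at least
  -- `ρ * #X` vertices of `X`. The unpopular colours cover at most `n * τ` vertices, so `A` is too
  -- small for `hlarge`.
  have hB : ColorableOn G S k {u ∈ A | f u ∈ P} := by
    refine ⟨f, le_trans (Finset.card_le_card ?_) (show #P ≤ k by omega),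
      fun u hu v hv => hf u (Finset.mem_filter.1 hu).1 v (Finset.mem_filter.1 hv).1⟩
    intro j hj
    obtain ⟨u, hu, rfl⟩ := Finset.mem_image.1 hj
    exact (Finset.mem_filter.1 hu).2
  have h1 := hX _ ((Finset.filter_subset _ _).trans hA) hB
  have h2 : (#{u ∈ A | f u ∉ P} : ℝ) ≤ n * τ := by
    have hmap : ∀ u ∈ ({u ∈ A | f u ∉ P} : Finset V), f u ∈ I \ P := fun u hu =>
      Finset.mem_sdiff.2 ⟨hI u (Finset.mem_filter.1 hu).1, (Finset.mem_filter.1 hu).2⟩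
    rw [Finset.card_eq_sum_card_fiberwise hmap]
    push_cast
    calc ∑ j ∈ I \ P, (#{u ∈ ({u ∈ A | f u ∉ P} : Finset V) | f u = j} : ℝ)
        ≤ ∑ j ∈ I \ P, τ := by
          refine Finset.sum_le_sum fun j hj => ?_
          obtain ⟨hjI, hjP⟩ := Finset.mem_sdiff.1 hj
          have : ¬ τ ≤ #{u ∈ A | f u = j} := fun h => hjP (Finset.mem_filter.2 ⟨hjI, h⟩)
          refine le_trans ?_ (not_le.1 this).le
          exact_mod_cast Finset.card_le_card
            (Finset.filter_subset_filter _ (Finset.filter_subset _ _))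
      _ = #(I \ P) * τ := by rw [Finset.sum_const, nsmul_eq_mul]
      _ ≤ n * τ := by
          refine mul_le_mul_of_nonneg_right ?_ hτ
          exact_mod_cast (Finset.card_le_card Finset.sdiff_subset).trans hn
  have h3 : (#A : ℝ) = #{u ∈ A | f u ∈ P} + #{u ∈ A | f u ∉ P} := by
    exact_mod_cast (Finset.card_filter_add_card_filter_not (s := A) (fun u => f u ∈ P)).symm
  linarith

/-- Two sets of large deficit, joined by a graph that has an edge between any two large
subsets, have a union whose deficit for about twice as many colours is still large. -/
theorem Deficit.join [DecidableEq V] [DecidableEq K] {c : K} {β ρ : ℝ} (hXY : Disjoint X Y)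
    (hcard : #X = #Y) (hβ : 0 ≤ β)
    (hreg : ∀ X' ⊆ X, ∀ Y' ⊆ Y, β * #X ≤ #X' → β * #Y ≤ #Y' →
      ∃ x ∈ X', ∃ y ∈ Y', (G c).Adj x y)
    (hβρ : (2 * k + 1) * β ≤ ρ / 2)
    (hX : Deficit G S k X (ρ * #X)) (hY : Deficit G S k Y (ρ * #Y)) :
    Deficit G (insert c S) (2 * k + 1) (X ∪ Y) (ρ / 4 * #(X ∪ Y)) := by
  rintro A hA ⟨f, hk, hf⟩
  by_contra hcon
  rw [not_le] at hcon
  have hU : (#(X ∪ Y) : ℝ) = #X + #Y := by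
    exact_mod_cast Finset.card_union_of_disjoint hXY
  have hc' : (#Y : ℝ) = #X := by exact_mod_cast hcard.symm
  rw [hU, hc'] at hcon
  have hAX : (#A : ℝ) ≤ #(A ∩ X) + #(A ∩ Y) := by
    have h3 : #A ≤ #(A ∩ X) + #(A ∩ Y) := by
      calc #A = #(A ∩ (X ∪ Y)) := by rw [Finset.inter_eq_left.2 hA]
        _ ≤ _ := by rw [Finset.inter_union_distrib_left]; exact Finset.card_union_le _ _
    exact_mod_cast h3
  have hAX1 : (#(A ∩ X) : ℝ) ≤ #X := by
    exact_mod_cast Finset.card_le_card Finset.inter_subset_right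
  have hAY1 : (#(A ∩ Y) : ℝ) ≤ #Y := by
    exact_mod_cast Finset.card_le_card Finset.inter_subset_right
  rw [hc'] at hAY1
  -- The budget `ρ` of each side is split in two: `A` misses less than `ρ / 2 * #X` vertices in
  -- total, and the colours used fewer than `β * #X` times account for at most another `ρ / 2 * #X`.
  have hτ : ((2 * k + 1 : ℕ) : ℝ) * (β * #X) ≤ ρ / 2 * #X := by
    push_cast
    calc (2 * (k : ℝ) + 1) * (β * #X) = ((2 * k + 1) * β) * #X := by ring
      _ ≤ _ := mul_le_mul_of_nonneg_right hβρ (Nat.cast_nonneg _)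
  have hpX := hX.le_card_popular (A := A ∩ X) Finset.inter_subset_right f (I := A.image f)
    (n := 2 * k + 1) (τ := β * #X)
    (fun u hu => Finset.mem_image_of_mem f (Finset.mem_inter.1 hu).1) hk (by positivity)
    (fun u hu v hv i hi => hf u (Finset.mem_inter.1 hu).1 v (Finset.mem_inter.1 hv).1 i
      (Finset.mem_insert_of_mem hi)) (by linarith)
  have hpY := hY.le_card_popular (A := A ∩ Y) Finset.inter_subset_right f (I := A.image f)
    (n := 2 * k + 1) (τ := β * #Y)
    (fun u hu => Finset.mem_image_of_mem f (Finset.mem_inter.1 hu).1) hk (by positivity)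
    (fun u hu v hv i hi => hf u (Finset.mem_inter.1 hu).1 v (Finset.mem_inter.1 hv).1 i
      (Finset.mem_insert_of_mem hi)) (by rw [hc']; linarith)
  set PX : Finset ℕ := {j ∈ A.image f | β * #X ≤ #{u ∈ A ∩ X | f u = j}}
  set PY : Finset ℕ := {j ∈ A.image f | β * #Y ≤ #{u ∈ A ∩ Y | f u = j}}
  -- Two sets of at least `k + 1` colours among `2 * k + 1` must meet. Iterating `k ↦ 2 * k + 1`
  -- from `0` produces `2 ^ i - 1`.
  have hne : ¬ Disjoint PX PY := by
    intro hd
    have h1 := Finset.card_union_of_disjoint hd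
    have h2 : #(PX ∪ PY) ≤ #(A.image f) := Finset.card_le_card
      (Finset.union_subset (Finset.filter_subset _ _) (Finset.filter_subset _ _))
    omega
  obtain ⟨j, hjX, hjY⟩ := Finset.not_disjoint_iff.1 hne
  obtain ⟨x, hx, y, hy, hxy⟩ := hreg {u ∈ A ∩ X | f u = j}
    ((Finset.filter_subset _ _).trans Finset.inter_subset_right) {u ∈ A ∩ Y | f u = j}
    ((Finset.filter_subset _ _).trans Finset.inter_subset_right)
    (Finset.mem_filter.1 hjX).2 (Finset.mem_filter.1 hjY).2
  rw [Finset.mem_filter, Finset.mem_inter] at hx hy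
  exact hf x hx.1.1 y hy.1.1 c (Finset.mem_insert_self _ _) hxy (hx.2.trans hy.2.symm)

end Deficit

/-! ### Regular pairs by density increment -/

section RegularPair

variable {V K : Type*}

/-- Delete an element of least value repeatedly. If that value is at most `δ`, the bound drops by at
least as much as the sum; otherwise every remaining value exceeds `δ`. -/
theorem exists_subset_card_eq_mul_le_sum (f : V → ℝ) (δ : ℝ) {m : ℕ} (B : Finset V)
    (hm : m ≤ #B) (h : δ * #B ≤ ∑ b ∈ B, f b) :
    ∃ B₀ ⊆ B, #B₀ = m ∧ δ * m ≤ ∑ b ∈ B₀, f b := by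
  classical
  obtain ⟨d, hd⟩ := Nat.exists_eq_add_of_le hm
  induction d generalizing B with
  | zero => exact ⟨B, subset_rfl, hd, by simpa [hd] using h⟩
  | succ d ih =>
    have hne : B.Nonempty := by
      rw [← Finset.card_pos]; omega
    obtain ⟨b, hb, hmin⟩ := Finset.exists_min_image B f hne
    have hcard : #(B.erase b) = #B - 1 := Finset.card_erase_of_mem hb
    have hpos : 1 ≤ #B := Finset.card_pos.2 hne
    have hcardR : (#(B.erase b) : ℝ) = #B - 1 := by
      rw [hcard]; push_cast [Nat.cast_sub hpos]; ring
    have hsum := Finset.add_sum_erase B f hb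
    have hmin' : (#B : ℝ) * f b ≤ ∑ b ∈ B, f b := by
      rw [← nsmul_eq_mul]; exact Finset.card_nsmul_le_sum _ _ _ hmin
    have hle : δ * #(B.erase b) ≤ ∑ x ∈ B.erase b, f x := by
      rw [hcardR]
      by_cases hfb : f b ≤ δ
      · linarith
      · have h1 : (#(B.erase b) : ℝ) * f b ≤ ∑ x ∈ B.erase b, f x := by
          rw [← nsmul_eq_mul]
          exact Finset.card_nsmul_le_sum _ _ _ fun x hx => hmin x (Finset.mem_of_mem_erase hx)
        refine le_trans ?_ h1
        rw [← hcardR, mul_comm]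
        exact mul_le_mul_of_nonneg_left (not_le.1 hfb).le (Nat.cast_nonneg _)
    obtain ⟨B₀, h1, h2, h3⟩ := ih (B.erase b) (by omega) hle (by omega)
    exact ⟨B₀, h1.trans (Finset.erase_subset _ _), h2, h3⟩

/-- Averaging: a pair of sets contains a pair of prescribed sizes that is at least as dense. -/
theorem exists_subsets_card_eq_mul_le_sum (w : V → V → ℝ) {δ : ℝ} {m : ℕ} {A B : Finset V}
    (hA : m ≤ #A) (hB : m ≤ #B) (h : δ * (#A * #B) ≤ ∑ x ∈ A, ∑ y ∈ B, w x y) :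
    ∃ A₀ ⊆ A, ∃ B₀ ⊆ B, #A₀ = m ∧ #B₀ = m ∧
      δ * (m : ℝ) ^ 2 ≤ ∑ x ∈ A₀, ∑ y ∈ B₀, w x y := by
  obtain ⟨A₀, hA₀, hcA, hsA⟩ := exists_subset_card_eq_mul_le_sum (fun x => ∑ y ∈ B, w x y)
    (δ * #B) A hA (by linarith)
  rw [Finset.sum_comm] at hsA
  obtain ⟨B₀, hB₀, hcB, hsB⟩ := exists_subset_card_eq_mul_le_sum (fun y => ∑ x ∈ A₀, w x y)
    (δ * m) B hB (by linarith)
  refine ⟨A₀, hA₀, B₀, hB₀, hcA, hcB, ?_⟩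
  rw [Finset.sum_comm]
  linarith [hsB]

/-- Density increment: a pair of density at least `(1 - β²) ^ j` contains a pair, smaller by
a factor of at most `β ^ j`, without zero rectangles of relative side lengths `β`. -/
theorem exists_subpair_without_zero_rectangle (w : V → V → ℝ)
    (hw1 : ∀ x y, w x y ≤ 1) {β : ℝ} (hβ : 0 < β) (hβ4 : β ≤ 1 / 4) (j : ℕ) :
    ∀ (m : ℕ) (X Y : Finset V), 0 < m → #X = m → #Y = m →
      (1 - β ^ 2) ^ j * (m : ℝ) ^ 2 ≤ ∑ x ∈ X, ∑ y ∈ Y, w x y →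
      ∃ X₀ ⊆ X, ∃ Y₀ ⊆ Y, #X₀ = #Y₀ ∧ 0 < #X₀ ∧ β ^ j * m ≤ #X₀ ∧
        ∀ X' ⊆ X₀, ∀ Y' ⊆ Y₀, β * #X₀ ≤ #X' → β * #Y₀ ≤ #Y' →
          ∃ x ∈ X', ∃ y ∈ Y', w x y ≠ 0 := by
  classical
  have hrect : ∀ A B : Finset V, ∑ x ∈ A, ∑ y ∈ B, w x y ≤ #A * #B := fun A B => by
    calc ∑ x ∈ A, ∑ y ∈ B, w x y ≤ ∑ x ∈ A, ∑ y ∈ B, (1 : ℝ) :=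
          Finset.sum_le_sum fun x _ => Finset.sum_le_sum fun y _ => hw1 x y
      _ = #A * #B := by simp
  have hsplit : ∀ (X Y X' Y' : Finset V), X' ⊆ X → Y' ⊆ Y →
      (∀ x ∈ X', ∀ y ∈ Y', w x y = 0) → ∑ x ∈ X, ∑ y ∈ Y, w x y =
        ∑ x ∈ X \ X', ∑ y ∈ Y, w x y + ∑ x ∈ X', ∑ y ∈ Y \ Y', w x y := by
    intro X Y X' Y' hX hY h0
    rw [← Finset.sum_sdiff hX]
    congr 1
    refine Finset.sum_congr rfl fun x hx => ?_
    rw [← Finset.sum_sdiff hY, Finset.sum_eq_zero (s := Y') (fun y hy => h0 x hx y hy), add_zero]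
  have hsub : ∀ {X X' : Finset V}, X' ⊆ X → (#(X \ X') : ℝ) = #X - #X' := fun {X X'} h => by
    rw [Finset.card_sdiff_of_subset h, Nat.cast_sub (Finset.card_le_card h)]
  have hβ1 : 0 < 1 - β ^ 2 := by nlinarith
  induction j with
  | zero =>
    intro m X Y hm hX hY h
    refine ⟨X, subset_rfl, Y, subset_rfl, hX.trans hY.symm, hX ▸ hm, by simp [hX], ?_⟩
    -- Here the density is `1` and `w ≤ 1`, which leaves no room for a zero rectangle of positive
    -- area.
    intro X' hX' Y' hY' hcX hcY
    by_contra hno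
    push Not at hno
    have h1 := hsplit X Y X' Y' hX' hY' hno
    have h2 := hrect (X \ X') Y
    have h3 := hrect X' (Y \ Y')
    rw [hsub hX', hX, hY] at h2
    rw [hsub hY', hY] at h3
    rw [hX] at hcX
    rw [hY] at hcY
    have hm' : (0 : ℝ) < m := by exact_mod_cast hm
    have h4 : 0 < (#X' : ℝ) * #Y' :=
      mul_pos (lt_of_lt_of_le (by positivity) hcX) (lt_of_lt_of_le (by positivity) hcY)
    nlinarith
  | succ j ih =>
    intro m X Y hm hX hY h
    by_cases hreg : ∀ X' ⊆ X, ∀ Y' ⊆ Y, β * #X ≤ #X' → β * #Y ≤ #Y' →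
          ∃ x ∈ X', ∃ y ∈ Y', w x y ≠ 0
    · refine ⟨X, subset_rfl, Y, subset_rfl, hX.trans hY.symm, hX ▸ hm, ?_, hreg⟩
      rw [hX]
      exact mul_le_of_le_one_left (Nat.cast_nonneg _) (pow_le_one₀ hβ.le (by linarith))
    push Not at hreg
    obtain ⟨X₁, hX₁, Y₁, hY₁, hcX₁, hcY₁, h0₁⟩ := hreg
    have hm' : (0 : ℝ) < m := by exact_mod_cast hm
    rw [hX] at hcX₁
    rw [hY] at hcY₁
    set t : ℕ := ⌈β * m⌉₊ with ht
    have htβ : β * m ≤ t := Nat.le_ceil _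
    have htlt : (t : ℝ) < β * m + 1 := Nat.ceil_lt_add_one (by positivity)
    have ht0 : 0 < t := Nat.ceil_pos.2 (by positivity)
    obtain ⟨X', hX'₁, hcX'⟩ := Finset.exists_subset_card_eq (Nat.ceil_le.2 hcX₁)
    obtain ⟨Y', hY'₁, hcY'⟩ := Finset.exists_subset_card_eq (Nat.ceil_le.2 hcY₁)
    rw [← ht] at hcX' hcY'
    have hX' := hX'₁.trans hX₁
    have hY' := hY'₁.trans hY₁
    have h0 : ∀ x ∈ X', ∀ y ∈ Y', w x y = 0 := fun x hx y hy => h0₁ x (hX'₁ hx) y (hY'₁ hy)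
    have h1 := hsplit X Y X' Y' hX' hY' h0
    have htm : t ≤ m := by rw [← hcX', ← hX]; exact Finset.card_le_card hX'
    have hcX2 : #(X \ X') = m - t := by rw [Finset.card_sdiff_of_subset hX', hX, hcX']
    have hcY2 : #(Y \ Y') = m - t := by rw [Finset.card_sdiff_of_subset hY', hY, hcY']
    -- For `m = 1` the zero rectangle would be the whole pair, contradicting positive density. From
    -- `m ≥ 2` and `β ≤ 1 / 4` it follows that `m - t ≥ β * m` despite the rounding in `t`.
    have hm2 : 2 ≤ m := by
      by_contra hlt
      have hm1 : m = 1 := by omega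
      have ht1 : t = 1 := by omega
      have e1 : X \ X' = ∅ := Finset.card_eq_zero.1 (by omega)
      have e2 : Y \ Y' = ∅ := Finset.card_eq_zero.1 (by omega)
      rw [e1, e2] at h1
      simp only [Finset.sum_empty, Finset.sum_const_zero, add_zero] at h1
      rw [h1] at h
      have : 0 < (1 - β ^ 2) ^ (j + 1) * (m : ℝ) ^ 2 := by positivity
      linarith
    have hm2' : (2 : ℝ) ≤ m := by exact_mod_cast hm2
    have hmt : ((m - t : ℕ) : ℝ) = m - t := Nat.cast_sub htm
    have hβmt : β * m ≤ ((m - t : ℕ) : ℝ) := by rw [hmt]; nlinarith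
    -- All the weight lies on two rectangles of total area `m ^ 2 - t ^ 2 ≤ (1 - β ^ 2) * m ^ 2`.
    -- One of them therefore gains a factor `1 / (1 - β ^ 2)` in density over the bound for `j + 1`.
    have key : (1 - β ^ 2) ^ j * (#(X \ X') * #Y) ≤ ∑ x ∈ X \ X', ∑ y ∈ Y, w x y ∨
        (1 - β ^ 2) ^ j * (#X' * #(Y \ Y')) ≤ ∑ x ∈ X', ∑ y ∈ Y \ Y', w x y := by
      by_contra hcon
      push Not at hcon
      obtain ⟨k1, k2⟩ := hcon
      rw [hcX2, hY, hmt] at k1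
      rw [hcY2, hcX', hmt] at k2
      have hp : 0 < (1 - β ^ 2) ^ j := by positivity
      have h6 : ((m : ℝ) - t) * m + t * (m - t) = m ^ 2 - t ^ 2 := by ring
      have h7 : (m : ℝ) ^ 2 - t ^ 2 ≤ (1 - β ^ 2) * m ^ 2 := by nlinarith [mul_pos hβ hm']
      have h8 := mul_le_mul_of_nonneg_left h7 hp.le
      rw [← h6] at h8
      rw [pow_succ] at h
      nlinarith
    have finish : ∀ (A B : Finset V) (a : ℕ), A ⊆ X → B ⊆ Y → a ≤ #A → a ≤ #B →
        β * m ≤ a → (1 - β ^ 2) ^ j * (#A * #B) ≤ ∑ x ∈ A, ∑ y ∈ B, w x y →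
        ∃ X₀ ⊆ X, ∃ Y₀ ⊆ Y, #X₀ = #Y₀ ∧ 0 < #X₀ ∧ β ^ (j + 1) * m ≤ #X₀ ∧
        ∀ X' ⊆ X₀, ∀ Y' ⊆ Y₀, β * #X₀ ≤ #X' → β * #Y₀ ≤ #Y' →
          ∃ x ∈ X', ∃ y ∈ Y', w x y ≠ 0 := by
      intro A B a hAX hBY haA haB ha hsum
      obtain ⟨A₀, hA₀, B₀, hB₀, hcA₀, hcB₀, hs⟩ := exists_subsets_card_eq_mul_le_sum w haA haB hsum
      have ha0 : 0 < a := by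
        have : (0 : ℝ) < a := lt_of_lt_of_le (by positivity) ha
        exact_mod_cast this
      obtain ⟨X₀, hX₀, Y₀, hY₀, e1, e2, e3, e4⟩ := ih a A₀ B₀ ha0 hcA₀ hcB₀ hs
      refine ⟨X₀, hX₀.trans (hA₀.trans hAX), Y₀, hY₀.trans (hB₀.trans hBY), e1, e2, ?_, e4⟩
      refine le_trans ?_ e3
      rw [pow_succ, mul_assoc]
      exact mul_le_mul_of_nonneg_left ha (by positivity)
    rcases key with hk | hk
    · exact finish _ _ (m - t) Finset.sdiff_subset subset_rfl hcX2.ge (by omega) hβmt hk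
    · refine finish _ _ (min t (m - t)) hX' Finset.sdiff_subset (by omega) (by omega) ?_ hk
      rcases min_choice t (m - t) with e | e <;> rw [e] <;> assumption

/-- In a complete graph covered by `#K` graphs with chromatic number at most `k₀`, every vertex
set contains a not too small pair of independent sets in one of the graphs that has edges between
any two large subsets. -/
theorem exists_regular_pair [Fintype K] [DecidableEq V] {G : K → SimpleGraph V}
    (hG : ∀ u v, u ≠ v → ∃ i, (G i).Adj u v) {k₀ : ℕ} {W : Finset V}
    (hcol : ∀ c, ColorableOn G {c} k₀ W) (hW : 2 ≤ #W) {β : ℝ} (hβ : 0 < β) (hβ4 : β ≤ 1 / 4)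
    {j : ℕ} (hj : (1 - β ^ 2) ^ j * (2 * Fintype.card K * k₀ ^ 2) ≤ 1) :
    ∃ (c : K) (X Y : Finset V), X ⊆ W ∧ Y ⊆ W ∧ Disjoint X Y ∧ #X = #Y ∧ 0 < #X ∧
      β ^ j * #W ≤ 2 * Fintype.card K * k₀ ^ 2 * #X ∧
      (∀ x ∈ X, ∀ y ∈ X, ¬ (G c).Adj x y) ∧ (∀ x ∈ Y, ∀ y ∈ Y, ¬ (G c).Adj x y) ∧
      ∀ X' ⊆ X, ∀ Y' ⊆ Y, β * #X ≤ #X' → β * #Y ≤ #Y' →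
        ∃ x ∈ X', ∃ y ∈ Y', (G c).Adj x y := by
  classical
  let w : K → V → V → ℝ := fun c x y => if (G c).Adj x y then 1 else 0
  have hw0 : ∀ c x y, 0 ≤ w c x y := fun c x y => by dsimp only [w]; split_ifs <;> norm_num
  have hw1 : ∀ c x y, w c x y ≤ 1 := fun c x y => by dsimp only [w]; split_ifs <;> norm_num
  have hwA : ∀ {c x y}, w c x y ≠ 0 → (G c).Adj x y := fun {c x y} h => by
    by_contra hn
    exact h (if_neg hn)
  set N : ℝ := (#W : ℝ) with hN
  have hN2 : 2 ≤ N := by rw [hN]; exact_mod_cast hW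
  -- Every ordered pair of distinct vertices is covered, and `N * (N - 1) ≥ N ^ 2 / 2` as `N ≥ 2`.
  -- The heaviest colour and then the heaviest pair of fibres of its colouring keep a fraction `1 /
  -- (#K * k₀ ^ 2)` of this weight, whence `D` below.
  have htot : N ^ 2 / 2 ≤ ∑ c, ∑ x ∈ W, ∑ y ∈ W, w c x y := by
    have h1 : ∀ x ∈ W, N - 1 ≤ ∑ y ∈ W, ∑ c, w c x y := by
      intro x hx
      calc N - 1 = ∑ y ∈ W.erase x, (1 : ℝ) := by
            rw [Finset.sum_const, Finset.card_erase_of_mem hx, nsmul_eq_mul, mul_one,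
              Nat.cast_sub (by omega)]
            simp [hN]
        _ ≤ ∑ y ∈ W.erase x, ∑ c, w c x y := by
            refine Finset.sum_le_sum fun y hy => ?_
            obtain ⟨i, hi⟩ := hG x y (Finset.ne_of_mem_erase hy).symm
            calc (1 : ℝ) = w i x y := (if_pos hi).symm
              _ ≤ _ := Finset.single_le_sum (f := fun c => w c x y) (fun c _ => hw0 c x y)
                (Finset.mem_univ i)
        _ ≤ _ := Finset.sum_le_sum_of_subset_of_nonneg (Finset.erase_subset _ _)
            fun y _ _ => Finset.sum_nonneg fun c _ => hw0 c x y
    calc N ^ 2 / 2 ≤ N * (N - 1) := by nlinarith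
      _ = ∑ x ∈ W, (N - 1) := by rw [Finset.sum_const, nsmul_eq_mul]
      _ ≤ ∑ x ∈ W, ∑ y ∈ W, ∑ c, w c x y := Finset.sum_le_sum h1
      _ = ∑ c, ∑ x ∈ W, ∑ y ∈ W, w c x y := by
          rw [Finset.sum_comm]
          simp_rw [Finset.sum_comm (s := W) (t := Finset.univ)]
          exact Finset.sum_congr rfl fun c _ => Finset.sum_comm
  have hKne : (Finset.univ : Finset K).Nonempty := by
    by_contra hne
    rw [Finset.not_nonempty_iff_eq_empty] at hne
    rw [hne, Finset.sum_empty] at htot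
    nlinarith
  have hr : (0 : ℝ) < Fintype.card K := by
    have : 0 < Fintype.card K := Finset.card_pos.2 hKne
    exact_mod_cast this
  obtain ⟨c, -, hc⟩ := Finset.exists_le_of_sum_le (s := (Finset.univ : Finset K)) hKne
    (f := fun _ => N ^ 2 / 2 / Fintype.card K) (g := fun c => ∑ x ∈ W, ∑ y ∈ W, w c x y)
    (by
      rw [Finset.sum_const, nsmul_eq_mul, Finset.card_univ, mul_div_cancel₀ _ hr.ne']
      exact htot)
  obtain ⟨f, hfk, hf⟩ := hcol c
  have hWne : W.Nonempty := Finset.card_pos.1 (by omega)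
  have hIne : (W.image f).Nonempty := hWne.image f
  have hk₀ : (0 : ℝ) < k₀ := by
    have : 0 < k₀ := (Finset.card_pos.2 hIne).trans_le hfk
    exact_mod_cast this
  have hfk' : (#(W.image f) : ℝ) ≤ k₀ := by exact_mod_cast hfk
  have hfiber : ∀ g : V → ℝ, ∑ x ∈ W, g x = ∑ a ∈ W.image f, ∑ x ∈ W with f x = a, g x :=
    fun g => (Finset.sum_fiberwise_of_maps_to (fun x hx => Finset.mem_image_of_mem f hx) g).symm
  have hpart : ∀ (g : V → ℝ) (z : ℝ), 0 ≤ z → z ≤ ∑ x ∈ W, g x →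
      ∃ a ∈ W.image f, z / k₀ ≤ ∑ x ∈ W with f x = a, g x := by
    intro g z hz h
    refine Finset.exists_le_of_sum_le hIne ?_
    rw [← hfiber, Finset.sum_const, nsmul_eq_mul]
    refine le_trans ?_ h
    calc (#(W.image f) : ℝ) * (z / k₀) ≤ k₀ * (z / k₀) :=
          mul_le_mul_of_nonneg_right hfk' (by positivity)
      _ = z := mul_div_cancel₀ _ hk₀.ne'
  obtain ⟨a, -, ha⟩ := hpart _ _ (by positivity) hc
  rw [Finset.sum_comm] at ha
  obtain ⟨b, -, hb⟩ := hpart _ _ (by positivity) ha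
  rw [Finset.sum_comm] at hb
  set A : Finset V := {x ∈ W | f x = a} with hA
  set B : Finset V := {x ∈ W | f x = b} with hB
  set D : ℝ := 2 * Fintype.card K * k₀ ^ 2 with hD
  have hD0 : 0 < D := by positivity
  have hb' : N ^ 2 / D ≤ ∑ x ∈ A, ∑ y ∈ B, w c x y := by
    refine le_of_eq_of_le ?_ hb
    rw [hD]; field_simp
  have hindep : ∀ a' : ℕ, ∀ x ∈ ({x ∈ W | f x = a'} : Finset V),
      ∀ y ∈ ({x ∈ W | f x = a'} : Finset V), ¬ (G c).Adj x y := by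
    intro a' x hx y hy hadj
    rw [Finset.mem_filter] at hx hy
    exact hf x hx.1 y hy.1 c (Finset.mem_singleton_self c) hadj (hx.2.trans hy.2.symm)
  have hab : a ≠ b := by
    rintro rfl
    have : ∑ x ∈ A, ∑ y ∈ A, w c x y = 0 :=
      Finset.sum_eq_zero fun x hx => Finset.sum_eq_zero fun y hy => if_neg (hindep a x hx y hy)
    have hb'' : N ^ 2 / D ≤ ∑ x ∈ A, ∑ y ∈ A, w c x y := hb'
    rw [this] at hb''
    have : 0 < N ^ 2 / D := by positivity
    linarith
  have hdisj : Disjoint A B := Finset.disjoint_left.2 fun x hxA hxB =>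
    hab ((Finset.mem_filter.1 hxA).2.symm.trans (Finset.mem_filter.1 hxB).2)
  have hAN : (#A : ℝ) ≤ N := by
    rw [hN]; exact_mod_cast Finset.card_le_card (Finset.filter_subset _ _)
  have hBN : (#B : ℝ) ≤ N := by
    rw [hN]; exact_mod_cast Finset.card_le_card (Finset.filter_subset _ _)
  have hrect : ∑ x ∈ A, ∑ y ∈ B, w c x y ≤ #A * #B := by
    calc ∑ x ∈ A, ∑ y ∈ B, w c x y ≤ ∑ x ∈ A, ∑ y ∈ B, (1 : ℝ) :=
          Finset.sum_le_sum fun x _ => Finset.sum_le_sum fun y _ => hw1 c x y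
      _ = #A * #B := by simp
  have hND : N ^ 2 ≤ D * (#A * #B) := by
    have := hb'.trans hrect
    rwa [div_le_iff₀ hD0, mul_comm] at this
  have hAD : N ≤ D * #A := by
    have : N * N ≤ N * (D * #A) := by
      nlinarith [mul_le_mul_of_nonneg_left hBN (by positivity : 0 ≤ D * (#A : ℝ))]
    exact le_of_mul_le_mul_left this (by linarith)
  have hBD : N ≤ D * #B := by
    have : N * N ≤ N * (D * #B) := by
      nlinarith [mul_le_mul_of_nonneg_left hAN (by positivity : 0 ≤ D * (#B : ℝ))]
    exact le_of_mul_le_mul_left this (by linarith)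
  obtain ⟨m, hmA, hmB, hmN⟩ : ∃ m : ℕ, m ≤ #A ∧ m ≤ #B ∧ N ≤ D * m := by
    refine ⟨min #A #B, min_le_left _ _, min_le_right _ _, ?_⟩
    rcases min_choice (#A) (#B) with e | e <;> rw [e] <;> assumption
  have hm0 : 0 < m := by
    rcases Nat.eq_zero_or_pos m with rfl | h
    · rw [Nat.cast_zero, mul_zero] at hmN; linarith
    · exact h
  -- The number `j` of increments is what raises a density of `1 / D` to `1`.
  have hjD : (1 - β ^ 2) ^ j ≤ 1 / D := by rwa [le_div_iff₀ hD0]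
  obtain ⟨A₀, hA₀, B₀, hB₀, hcA₀, hcB₀, hs⟩ := exists_subsets_card_eq_mul_le_sum (w c)
    (δ := 1 / D) hmA hmB (by
      refine le_trans ?_ hb'
      rw [one_div, div_eq_inv_mul]
      refine mul_le_mul_of_nonneg_left ?_ (by positivity)
      nlinarith [mul_le_mul hAN hBN (Nat.cast_nonneg _) (by linarith)])
  obtain ⟨X, hX, Y, hY, e1, e2, e3, e4⟩ := exists_subpair_without_zero_rectangle (w c)
    (hw1 c) hβ hβ4 j m A₀ B₀ hm0 hcA₀ hcB₀
    (le_trans (mul_le_mul_of_nonneg_right hjD (by positivity)) hs)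
  have hXA := hX.trans hA₀
  have hYB := hY.trans hB₀
  refine ⟨c, X, Y, hXA.trans (Finset.filter_subset _ _), hYB.trans (Finset.filter_subset _ _),
    Finset.disjoint_of_subset_left hXA (Finset.disjoint_of_subset_right hYB hdisj), e1, e2, ?_,
    fun x hx y hy => hindep a x (hXA hx) y (hXA hy),
    fun x hx y hy => hindep b x (hYB hx) y (hYB hy), ?_⟩
  · calc β ^ j * N ≤ β ^ j * (D * m) := mul_le_mul_of_nonneg_left hmN (by positivity)
      _ = D * (β ^ j * m) := by ring
      _ ≤ D * #X := mul_le_mul_of_nonneg_left e3 hD0.le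
  · intro X' hX' Y' hY' h1 h2
    obtain ⟨x, hx, y, hy, hne⟩ := e4 X' hX' Y' hY' h1 h2
    exact ⟨x, hx, y, hy, hwA hne⟩

end RegularPair

/-! ### Trees of regular pairs and the energy argument -/

section Profile

variable {V K ι : Type*} [Fintype K] [DecidableEq K] [Fintype ι]

/-- Averaged data of a tree of height `ℓ` of nested subsets of `W` whose leaves are subsets with
many indices `s` such that the colour set `col s` has large deficit: `m s` is the proportion of
leaves with that property for `s`, and `u c s` is the proportion of branches that meet a node
where two subtrees sharing `s` are joined by the colour `c`. -/
structure IsProfile (G : K → SimpleGraph V) (col : ι → Finset K) (k : ℕ) (η : ℝ) (ℓ : ℕ)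
    (σ : ℝ) (W : Finset V) (m : ι → ℝ) (u : K → ι → ℝ) : Prop where
  m_nonneg : ∀ s, 0 ≤ m s
  m_le_one : ∀ s, m s ≤ 1
  sum_m : η * Fintype.card ι ≤ ∑ s, m s
  deficit_m : ∀ s, Deficit G (col s) k W (σ * η * m s * #W)
  u_nonneg : ∀ c s, 0 ≤ u c s
  u_le_one : ∀ c s, u c s ≤ 1
  u_support : ∀ c, (∀ x ∈ W, ∀ y ∈ W, ¬ (G c).Adj x y) → ∀ s, u c s = 0
  deficit_u : ∀ c s, Deficit G (insert c (col s)) (2 * k + 1) W (σ * (η ^ 2 / 32) * u c s * #W)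
  sum_u : η / 2 * Fintype.card ι * ℓ - 1 / η * (Fintype.card ι - ∑ s, m s ^ 2) ≤
    ∑ c, ∑ s, u c s

variable {G : K → SimpleGraph V} {col : ι → Finset K} {k : ℕ} {η : ℝ} {ℓ : ℕ} {σ : ℝ}
  {W : Finset V}

-- A single leaf: `m` is the indicator of the good indices and nothing has been joined. The lower
-- bound on `∑ u` is non-positive, since an indicator has `∑ m ^ 2` at most `|ι|`.
open Classical in
theorem exists_isProfile_zero (hη : 0 ≤ η)
    (h : η * Fintype.card ι ≤ #{s | Deficit G (col s) k W (η * #W)}) :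
    ∃ m u, IsProfile G col k η 0 1 W m u := by
  refine ⟨fun s => if Deficit G (col s) k W (η * #W) then 1 else 0, fun _ _ => 0, ?_, ?_, ?_, ?_,
    by simp, by simp, by simp, ?_, ?_⟩
  · intro s; split_ifs <;> norm_num
  · intro s; split_ifs <;> norm_num
  · rw [Finset.sum_boole]; exact h
  · intro s
    split_ifs with hs
    · simpa using hs
    · simpa using deficit_zero
  · intro c s
    simpa using deficit_zero
  · have h1 : ∑ s, (if Deficit G (col s) k W (η * #W) then (1 : ℝ) else 0) ^ 2 ≤
        Fintype.card ι := by
      calc _ ≤ ∑ _s : ι, (1 : ℝ) := Finset.sum_le_sum fun s _ => by split_ifs <;> norm_num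
        _ = _ := by simp
    have := mul_nonneg (one_div_nonneg.2 hη) (sub_nonneg.2 h1)
    simp only [Nat.cast_zero, mul_zero, zero_sub, Finset.sum_const_zero]
    linarith

variable [DecidableEq V]

/-- Take averages weighted by size; deficits add. Convexity of the square goes the right way:
averaging can only lower the energy, which weakens the bound required in `sum_u`. -/
theorem IsProfile.union {W₁ W₂ : Finset V} {m₁ m₂ : ι → ℝ} {u₁ u₂ : K → ι → ℝ} (hη : 0 < η)
    (h₁ : IsProfile G col k η ℓ σ W₁ m₁ u₁) (h₂ : IsProfile G col k η ℓ σ W₂ m₂ u₂)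
    (hd : Disjoint W₁ W₂) (hne : 0 < #W₁ + #W₂) :
    ∃ m u, IsProfile G col k η ℓ σ (W₁ ∪ W₂) m u := by
  have hN : (#(W₁ ∪ W₂) : ℝ) = #W₁ + #W₂ := by exact_mod_cast Finset.card_union_of_disjoint hd
  have hN0 : (0 : ℝ) < #W₁ + #W₂ := by exact_mod_cast hne
  obtain ⟨w₁, hw₁⟩ : ∃ w, w = (#W₁ : ℝ) / (#W₁ + #W₂) := ⟨_, rfl⟩
  obtain ⟨w₂, hw₂⟩ : ∃ w, w = (#W₂ : ℝ) / (#W₁ + #W₂) := ⟨_, rfl⟩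
  have hw₁0 : 0 ≤ w₁ := by rw [hw₁]; positivity
  have hw₂0 : 0 ≤ w₂ := by rw [hw₂]; positivity
  have hw : w₁ + w₂ = 1 := by rw [hw₁, hw₂, ← add_div, div_self hN0.ne']
  have hwN₁ : w₁ * #(W₁ ∪ W₂) = #W₁ := by rw [hN, hw₁, div_mul_cancel₀ _ hN0.ne']
  have hwN₂ : w₂ * #(W₁ ∪ W₂) = #W₂ := by rw [hN, hw₂, div_mul_cancel₀ _ hN0.ne']
  refine ⟨fun s => w₁ * m₁ s + w₂ * m₂ s, fun c s => w₁ * u₁ c s + w₂ * u₂ c s, ?_, ?_, ?_, ?_,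
    ?_, ?_, ?_, ?_, ?_⟩
  · intro s
    have := h₁.m_nonneg s
    have := h₂.m_nonneg s
    positivity
  · intro s
    have e1 := mul_le_mul_of_nonneg_left (h₁.m_le_one s) hw₁0
    have e2 := mul_le_mul_of_nonneg_left (h₂.m_le_one s) hw₂0
    linarith
  · rw [Finset.sum_add_distrib, ← Finset.mul_sum, ← Finset.mul_sum]
    have e1 := mul_le_mul_of_nonneg_left h₁.sum_m hw₁0
    have e2 := mul_le_mul_of_nonneg_left h₂.sum_m hw₂0
    have e3 : η * Fintype.card ι = (w₁ + w₂) * (η * Fintype.card ι) := by rw [hw, one_mul]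
    rw [e3]
    linarith
  · intro s
    have := (h₁.deficit_m s).add (h₂.deficit_m s) hd
    rw [← hwN₁, ← hwN₂] at this
    exact this.anti (le_of_eq (by ring))
  · intro c s
    have := h₁.u_nonneg c s
    have := h₂.u_nonneg c s
    positivity
  · intro c s
    have e1 := mul_le_mul_of_nonneg_left (h₁.u_le_one c s) hw₁0
    have e2 := mul_le_mul_of_nonneg_left (h₂.u_le_one c s) hw₂0
    linarith
  · intro c hc s
    have e1 := h₁.u_support c (fun x hx y hy => hc x (Finset.mem_union_left _ hx) y
      (Finset.mem_union_left _ hy)) s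
    have e2 := h₂.u_support c (fun x hx y hy => hc x (Finset.mem_union_right _ hx) y
      (Finset.mem_union_right _ hy)) s
    simp [e1, e2]
  · intro c s
    have := (h₁.deficit_u c s).add (h₂.deficit_u c s) hd
    rw [← hwN₁, ← hwN₂] at this
    exact this.anti (le_of_eq (by ring))
  · have hsq : ∑ s, (w₁ * m₁ s + w₂ * m₂ s) ^ 2 ≤
        w₁ * ∑ s, m₁ s ^ 2 + w₂ * ∑ s, m₂ s ^ 2 := by
      rw [Finset.mul_sum, Finset.mul_sum, ← Finset.sum_add_distrib]
      refine Finset.sum_le_sum fun s _ => ?_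
      obtain rfl : w₂ = 1 - w₁ := by linarith
      nlinarith [mul_nonneg (mul_nonneg hw₁0 hw₂0) (sq_nonneg (m₁ s - m₂ s))]
    have hsum : ∑ c, ∑ s, (w₁ * u₁ c s + w₂ * u₂ c s) =
        w₁ * ∑ c, ∑ s, u₁ c s + w₂ * ∑ c, ∑ s, u₂ c s := by
      simp only [Finset.sum_add_distrib, Finset.mul_sum]
    rw [hsum]
    have e1 := mul_le_mul_of_nonneg_left h₁.sum_u hw₁0
    have e2 := mul_le_mul_of_nonneg_left h₂.sum_u hw₂0
    have e3 := mul_le_mul_of_nonneg_left hsq (one_div_pos.2 hη).le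
    have e4 : η / 2 * (Fintype.card ι : ℝ) * ℓ = (w₁ + w₂) * (η / 2 * Fintype.card ι * ℓ) := by
      rw [hw, one_mul]
    have e5 : 1 / η * (Fintype.card ι : ℝ) = (w₁ + w₂) * (1 / η * Fintype.card ι) := by
      rw [hw, one_mul]
    linarith

/-- Two profiles with total mass `η * |ι|` share many indices, up to a variance term. -/
theorem le_card_common (hη : 0 < η) {m₁ m₂ : ι → ℝ}
    (hm₁ : ∀ s, m₁ s ≤ 1)
    (h₁ : η * Fintype.card ι ≤ ∑ s, m₁ s) (h₂ : η * Fintype.card ι ≤ ∑ s, m₂ s) :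
    η / 2 * Fintype.card ι - 1 / η * ∑ s, ((m₁ s - m₂ s) / 2) ^ 2 ≤
      ∑ s, (if η / 4 ≤ m₁ s ∧ η / 4 ≤ m₂ s then (1 : ℝ) else 0) := by
  have key : ∀ s, (m₁ s + m₂ s) / 2 - η / 2 - 1 / η * ((m₁ s - m₂ s) / 2) ^ 2 ≤
      (if η / 4 ≤ m₁ s ∧ η / 4 ≤ m₂ s then (1 : ℝ) else 0) := by
    intro s
    -- The minimum is the mean minus half the difference; this trades the difference for its square
    -- by completing a square.
    have h3 : |m₁ s - m₂ s| / 2 ≤ η / 4 + 1 / η * ((m₁ s - m₂ s) / 2) ^ 2 := by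
      have e : η / 4 + 1 / η * ((m₁ s - m₂ s) / 2) ^ 2 - |m₁ s - m₂ s| / 2 =
          (|m₁ s - m₂ s| - η) ^ 2 / (4 * η) := by
        rw [div_pow, ← sq_abs (m₁ s - m₂ s)]
        field_simp
        ring
      have : 0 ≤ (|m₁ s - m₂ s| - η) ^ 2 / (4 * η) := by positivity
      linarith
    have h4 : (m₁ s + m₂ s) / 2 - |m₁ s - m₂ s| / 2 = min (m₁ s) (m₂ s) := by
      have := max_sub_min_eq_abs' (m₁ s) (m₂ s)
      have := max_add_min (m₁ s) (m₂ s)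
      linarith
    have h5 : (m₁ s + m₂ s) / 2 - η / 2 - 1 / η * ((m₁ s - m₂ s) / 2) ^ 2 ≤
        min (m₁ s) (m₂ s) - η / 4 := by linarith
    refine h5.trans ?_
    split_ifs with h
    · have := (min_le_left (m₁ s) (m₂ s)).trans (hm₁ s)
      linarith
    · have : min (m₁ s) (m₂ s) < η / 4 := by
        rw [min_lt_iff]
        by_contra hn
        push Not at hn
        exact h hn
      linarith
  have hs := Finset.sum_le_sum fun s (_ : s ∈ (Finset.univ : Finset ι)) => key s
  refine le_trans ?_ hs
  rw [Finset.sum_sub_distrib, Finset.sum_sub_distrib, ← Finset.mul_sum, ← Finset.sum_div,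
    Finset.sum_add_distrib, Finset.sum_const, Finset.card_univ, nsmul_eq_mul]
  linarith

/-- Joining two sets with profiles of height `ℓ` by a pair that is regular in a new colour gives
a profile of height `ℓ + 1`. -/
theorem IsProfile.node {X Y : Finset V} {m₁ m₂ : ι → ℝ} {u₁ u₂ : K → ι → ℝ} {c : K} {β : ℝ}
    (hη : 0 < η) (hσ : 1 / 2 ≤ σ) (hσ1 : σ ≤ 1)
    (h₁ : IsProfile G col k η ℓ σ X m₁ u₁) (h₂ : IsProfile G col k η ℓ σ Y m₂ u₂)
    (hXY : Disjoint X Y) (hcard : #X = #Y) (hβ : 0 ≤ β) (hβ1 : β ≤ 1)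
    (hβη : (2 * k + 1) * β ≤ η ^ 2 / 16)
    (hX : ∀ x ∈ X, ∀ y ∈ X, ¬ (G c).Adj x y) (hY : ∀ x ∈ Y, ∀ y ∈ Y, ¬ (G c).Adj x y)
    (hreg : ∀ X' ⊆ X, ∀ Y' ⊆ Y, β * #X ≤ #X' → β * #Y ≤ #Y' →
      ∃ x ∈ X', ∃ y ∈ Y', (G c).Adj x y) :
    ∃ m u, IsProfile G col k η (ℓ + 1) σ (X ∪ Y) m u := by
  classical
  have hN : (#(X ∪ Y) : ℝ) = #X + #Y := by exact_mod_cast Finset.card_union_of_disjoint hXY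
  have hc' : (#Y : ℝ) = #X := by exact_mod_cast hcard.symm
  have hNX : (#X : ℝ) = #(X ∪ Y) / 2 := by rw [hN, hc']; ring
  have hNY : (#Y : ℝ) = #(X ∪ Y) / 2 := by rw [hN, hc']; ring
  let p : ι → ℝ := fun s => if η / 4 ≤ m₁ s ∧ η / 4 ≤ m₂ s then 1 else 0
  have hp0 : ∀ s, 0 ≤ p s := fun s => by dsimp only [p]; split_ifs <;> norm_num
  have hp1 : ∀ s, p s ≤ 1 := fun s => by dsimp only [p]; split_ifs <;> norm_num
  refine ⟨fun s => (m₁ s + m₂ s) / 2,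
    fun d s => (u₁ d s + u₂ d s) / 2 + if d = c then p s else 0, ?_, ?_, ?_, ?_,
    ?_, ?_, ?_, ?_, ?_⟩
  · intro s
    have := h₁.m_nonneg s
    have := h₂.m_nonneg s
    positivity
  · intro s
    linarith [h₁.m_le_one s, h₂.m_le_one s]
  · rw [← Finset.sum_div, Finset.sum_add_distrib]
    linarith [h₁.sum_m, h₂.sum_m]
  · intro s
    have := (h₁.deficit_m s).add (h₂.deficit_m s) hXY
    rw [hNX, hNY] at this
    exact this.anti (le_of_eq (by ring))
  · intro d s
    have := h₁.u_nonneg d s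
    have := h₂.u_nonneg d s
    have := hp0 s
    positivity
  · intro d s
    -- At the new colour both subtrees contribute `0`, because `X` and `Y` are independent in it.
    -- This keeps `u ≤ 1` however high the tree grows.
    split_ifs with hd
    · subst hd
      rw [h₁.u_support d hX, h₂.u_support d hY]
      linarith [hp1 s]
    · linarith [h₁.u_le_one d s, h₂.u_le_one d s]
  · intro d hd s
    have e1 := h₁.u_support d (fun x hx y hy => hd x (Finset.mem_union_left _ hx) y
      (Finset.mem_union_left _ hy)) s
    have e2 := h₂.u_support d (fun x hx y hy => hd x (Finset.mem_union_right _ hx) y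
      (Finset.mem_union_right _ hy)) s
    have hdc : d ≠ c := by
      rintro rfl
      obtain ⟨x, hx, y, hy, hxy⟩ := hreg X subset_rfl Y subset_rfl
        (mul_le_of_le_one_left (Nat.cast_nonneg _) hβ1)
        (mul_le_of_le_one_left (Nat.cast_nonneg _) hβ1)
      exact hd x (Finset.mem_union_left _ hx) y (Finset.mem_union_right _ hy) hxy
    simp [e1, e2, hdc]
  · intro d s
    by_cases hd : d = c
    · subst hd
      rw [h₁.u_support d hX, h₂.u_support d hY, if_pos rfl]
      by_cases hs : η / 4 ≤ m₁ s ∧ η / 4 ≤ m₂ s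
      -- A shared index has deficit at least `η ^ 2 / 8` on both sides, as `σ ≥ 1 / 2`; the join
      -- divides this by `4`, which is the `η ^ 2 / 32` of `deficit_u`.
      · have hcoef : ∀ z, η / 4 ≤ z → η ^ 2 / 8 ≤ σ * η * z := fun z hz => by
          have : 1 / 2 * η * (η / 4) ≤ σ * η * z := by gcongr
          linarith
        have e1 : Deficit G (col s) k X (η ^ 2 / 8 * #X) := (h₁.deficit_m s).anti
          (mul_le_mul_of_nonneg_right (hcoef _ hs.1) (Nat.cast_nonneg _))
        have e2 : Deficit G (col s) k Y (η ^ 2 / 8 * #Y) := (h₂.deficit_m s).anti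
          (mul_le_mul_of_nonneg_right (hcoef _ hs.2) (Nat.cast_nonneg _))
        refine (Deficit.join hXY hcard hβ hreg (by linarith) e1 e2).anti ?_
        have : p s = 1 := if_pos hs
        rw [this]
        refine mul_le_mul_of_nonneg_right ?_ (Nat.cast_nonneg _)
        nlinarith [sq_nonneg η]
      · have : p s = 0 := if_neg hs
        rw [this]
        simpa using deficit_zero
    · have := (h₁.deficit_u d s).add (h₂.deficit_u d s) hXY
      rw [hNX, hNY] at this
      rw [if_neg hd]
      exact this.anti (le_of_eq (by ring))
  · have hsum : ∑ d, ∑ s, ((u₁ d s + u₂ d s) / 2 + if d = c then p s else 0) =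
        (∑ d, ∑ s, u₁ d s + ∑ d, ∑ s, u₂ d s) / 2 + ∑ s, p s := by
      simp only [Finset.sum_add_distrib, ← Finset.sum_div]
      congr 1
      rw [Finset.sum_comm]
      exact Finset.sum_congr rfl fun s _ => by simp
    -- The parallelogram law: relative to the mean energy of the two sides, the energy of the
    -- average drops by exactly the variance that `le_card_common` loses, so the term `1 / η * (|ι|
    -- - ∑ m ^ 2)` pays for it.
    have hsq : ∑ s, ((m₁ s + m₂ s) / 2) ^ 2 =
        (∑ s, m₁ s ^ 2 + ∑ s, m₂ s ^ 2) / 2 - ∑ s, ((m₁ s - m₂ s) / 2) ^ 2 := by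
      rw [← Finset.sum_add_distrib, Finset.sum_div, ← Finset.sum_sub_distrib]
      exact Finset.sum_congr rfl fun s _ => by ring
    have hcom : _ ≤ ∑ s, p s := le_card_common hη h₁.m_le_one h₁.sum_m h₂.sum_m
    rw [hsum, hsq]
    push_cast
    linarith [h₁.sum_u, h₂.sum_u]

/-- The proportions stay as they are; the uncovered fraction `ω` is absorbed into `σ`, since `σ * (1
- ω) ≥ σ - ω` for `σ ≤ 1`. -/
theorem IsProfile.superset {A : Finset V} {m : ι → ℝ} {u : K → ι → ℝ} {ω : ℝ} (hη : 0 ≤ η)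
    (hσ0 : 0 ≤ σ) (hσ : σ ≤ 1) (h : IsProfile G col k η ℓ σ A m u) (hA : A ⊆ W)
    (hcard : (1 - ω) * #W ≤ #A) (hω : 0 ≤ ω) :
    IsProfile G col k η ℓ (σ - ω) W m u := by
  have hσω : (σ - ω) * #W ≤ σ * #A := by
    have h1 := mul_le_mul_of_nonneg_left hcard hσ0
    have h2 : 0 ≤ (1 - σ) * (ω * #W) :=
      mul_nonneg (sub_nonneg.2 hσ) (mul_nonneg hω (Nat.cast_nonneg _))
    nlinarith
  refine ⟨h.m_nonneg, h.m_le_one, h.sum_m, fun s => ?_, h.u_nonneg, h.u_le_one,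
    fun c hc => h.u_support c fun x hx y hy => hc x (hA hx) y (hA hy), fun c s => ?_, h.sum_u⟩
  · refine ((h.deficit_m s).mono hA).anti ?_
    have := mul_le_mul_of_nonneg_left hσω (mul_nonneg hη (h.m_nonneg s))
    linarith
  · refine ((h.deficit_u c s).mono hA).anti ?_
    have := mul_le_mul_of_nonneg_left hσω
      (mul_nonneg (show 0 ≤ η ^ 2 / 32 by positivity) (h.u_nonneg c s))
    linarith

/-- Exhausting a set by disjoint regular pairs raises the height of profiles by one. -/
theorem exists_isProfile_succ (hG : ∀ u v, u ≠ v → ∃ i, (G i).Adj u v) {k₀ : ℕ}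
    (hcol : ∀ c A, ColorableOn G {c} k₀ A) {β ω t : ℝ} {j : ℕ} (hη : 0 < η)
    (hσ : 1 / 2 ≤ σ) (hσ1 : σ ≤ 1) (hβ : 0 < β) (hβ4 : β ≤ 1 / 4)
    (hβη : (2 * k + 1) * β ≤ η ^ 2 / 16)
    (hj : (1 - β ^ 2) ^ j * (2 * Fintype.card K * k₀ ^ 2) ≤ 1)
    (hD : (1 : ℝ) ≤ 2 * Fintype.card K * k₀ ^ 2) (hω : 0 < ω) (hω1 : ω < 1)
    (ht : 2 ≤ t)
    (hprof : ∀ X : Finset V, t ≤ #X → ∃ m u, IsProfile G col k η ℓ σ X m u)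
    (hW : t * (2 * Fintype.card K * k₀ ^ 2 / (β ^ j * ω)) ≤ #W) :
    ∃ m u, IsProfile G col k η (ℓ + 1) (σ - ω) W m u := by
  classical
  have hβj : 0 < β ^ j := by positivity
  have hβj1 : β ^ j ≤ 1 := pow_le_one₀ hβ.le (by linarith)
  set D : ℝ := 2 * Fintype.card K * k₀ ^ 2
  have hWt : t * D ≤ β ^ j * (ω * #W) := by
    rw [← mul_div_assoc, div_le_iff₀ (by positivity)] at hW
    linarith
  have hWt' : t ≤ ω * #W := by
    have h1 : t ≤ t * D := le_mul_of_one_le_right (by linarith) hD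
    have h2 : β ^ j * (ω * #W) ≤ ω * #W := mul_le_of_le_one_left (by positivity) hβj1
    linarith
  have step : ∀ B : Finset V, B ⊆ W → ω * #W < #B →
      ∃ Z ⊆ B, Z.Nonempty ∧ ∃ m u, IsProfile G col k η (ℓ + 1) σ Z m u := by
    intro B hB hlt
    have hB2 : 2 ≤ #B := by
      have : (2 : ℝ) ≤ #B := by linarith
      exact_mod_cast this
    obtain ⟨c, X, Y, hX, hY, hd, hXY, hX0, hsize, hiX, hiY, hreg⟩ :=
      exists_regular_pair hG (fun c => hcol c B) hB2 hβ hβ4 hj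
    have hXt : t ≤ #X := by
      have h1 := mul_le_mul_of_nonneg_left hlt.le hβj.le
      have h2 : D * t ≤ D * #X := by linarith
      exact le_of_mul_le_mul_left h2 (by linarith)
    obtain ⟨m₁, u₁, h₁⟩ := hprof X hXt
    obtain ⟨m₂, u₂, h₂⟩ := hprof Y (by rw [← hXY]; exact hXt)
    exact ⟨X ∪ Y, Finset.union_subset hX hY, (Finset.card_pos.1 hX0).mono Finset.subset_union_left,
      h₁.node hη hσ hσ1 h₂ hd hXY hβ.le (by linarith) hβη hiX hiY hreg⟩
  have hW0 : (0 : ℝ) < #W := by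
    by_contra h
    have h' : (#W : ℝ) = 0 := le_antisymm (not_lt.1 h) (Nat.cast_nonneg _)
    rw [h', mul_zero] at hWt'
    linarith
  obtain ⟨Z₀, hZ₀, hZ₀ne, hZ₀p⟩ := step W subset_rfl (by nlinarith)
  -- A largest subset with a profile of height `ℓ + 1` leaves at most `ω * #W` vertices uncovered,
  -- as otherwise another node fits into the remainder and can be adjoined.
  obtain ⟨A, hA, hmax⟩ := Finset.exists_max_image
    {A ∈ W.powerset | A.Nonempty ∧ ∃ m u, IsProfile G col k η (ℓ + 1) σ A m u} Finset.card
    ⟨Z₀, Finset.mem_filter.2 ⟨Finset.mem_powerset.2 hZ₀, hZ₀ne, hZ₀p⟩⟩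
  obtain ⟨hAW, hAne, m, u, hAp⟩ := Finset.mem_filter.1 hA
  rw [Finset.mem_powerset] at hAW
  refine ⟨m, u, hAp.superset hη.le (by linarith) hσ1 hAW ?_ hω.le⟩
  by_contra hlt
  rw [not_le] at hlt
  have hsd : (#(W \ A) : ℝ) = #W - #A := by
    rw [Finset.card_sdiff_of_subset hAW, Nat.cast_sub (Finset.card_le_card hAW)]
  obtain ⟨Z, hZ, hZne, m', u', hZp⟩ := step (W \ A) Finset.sdiff_subset (by rw [hsd]; linarith)
  have hAZ : Disjoint A Z := Finset.disjoint_of_subset_right hZ Finset.disjoint_sdiff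
  have hmem := hmax (A ∪ Z) (Finset.mem_filter.2 ⟨Finset.mem_powerset.2
    (Finset.union_subset hAW (hZ.trans Finset.sdiff_subset)), hAne.mono Finset.subset_union_left,
    hAp.union hη hZp hAZ (by have := hAne.card_pos; omega)⟩)
  rw [Finset.card_union_of_disjoint hAZ] at hmem
  have := hZne.card_pos
  omega

open Classical in
/-- If every large set has large deficit for a positive proportion of the indices `s`, then every
somewhat larger set has large deficit, for about twice as many colours, for a positive proportion
of the pairs `(c, s)`. -/
theorem le_card_deficit_insert (hG : ∀ u v, u ≠ v → ∃ i, (G i).Adj u v) {k₀ : ℕ}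
    (hcol : ∀ c A, ColorableOn G {c} k₀ A) {β t : ℝ} {j L : ℕ} (hη : 0 < η)
    (hβ : 0 < β) (hβ4 : β ≤ 1 / 4)
    (hβη : (2 * k + 1) * β ≤ η ^ 2 / 16)
    (hj : (1 - β ^ 2) ^ j * (2 * Fintype.card K * k₀ ^ 2) ≤ 1)
    (hD : (1 : ℝ) ≤ 2 * Fintype.card K * k₀ ^ 2) (ht : 2 ≤ t) (hL : 4 / η ^ 2 ≤ L)
    (hdef : ∀ X : Finset V, t ≤ #X →
      η * Fintype.card ι ≤ #{s | Deficit G (col s) k X (η * #X)})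
    (hW : t * (2 * Fintype.card K * k₀ ^ 2 * (2 * L) / β ^ j) ^ L ≤ #W) :
    η * L / (8 * Fintype.card K) * Fintype.card (K × ι) ≤
      #{p : K × ι | Deficit G (insert p.1 (col p.2)) (2 * k + 1) W
        (η ^ 3 * L / (512 * Fintype.card K) * #W)} := by
  have hL0 : (0 : ℝ) < L := lt_of_lt_of_le (by positivity) hL
  set D : ℝ := 2 * Fintype.card K * k₀ ^ 2
  have hL1 : (1 : ℝ) ≤ L := by
    have : 0 < L := by exact_mod_cast hL0
    exact_mod_cast this
  have hr : (0 : ℝ) < Fintype.card K := by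
    rcases (Nat.cast_nonneg (α := ℝ) (Fintype.card K)).eq_or_lt with h | h
    · exfalso
      have : D = 0 := by simp only [D, ← h]; ring
      linarith
    · exact h
  -- The size lost per level, with `ω = 1 / (2 * L)`: after `L` levels `σ` has fallen from `1` to
  -- exactly `1 / 2`, the least that the node step tolerates.
  set Λ : ℝ := D * (2 * L) / β ^ j with hΛ
  have hβj1 : β ^ j ≤ 1 := pow_le_one₀ hβ.le (by linarith)
  have hΛ1 : 1 ≤ Λ := by
    rw [hΛ, one_le_div (by positivity)]
    nlinarith
  have main : ∀ ℓ : ℕ, ℓ ≤ L → ∀ X : Finset V, t * Λ ^ ℓ ≤ #X →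
      ∃ m u, IsProfile G col k η ℓ (1 - ℓ * (1 / (2 * L))) X m u := by
    intro ℓ
    induction ℓ with
    | zero =>
      intro _ X hX
      rw [pow_zero, mul_one] at hX
      simpa using exists_isProfile_zero hη.le (hdef X hX)
    | succ ℓ ih =>
      intro hℓ X hX
      have hℓ' : (ℓ : ℝ) ≤ L := by exact_mod_cast (by omega : ℓ ≤ L)
      have hσ : (ℓ : ℝ) * (1 / (2 * L)) ≤ 1 / 2 := by
        calc (ℓ : ℝ) * (1 / (2 * L)) ≤ L * (1 / (2 * L)) :=
              mul_le_mul_of_nonneg_right hℓ' (by positivity)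
          _ = 1 / 2 := by field_simp
      have hσ0 : 0 ≤ (ℓ : ℝ) * (1 / (2 * L)) := by positivity
      have ht' : 2 ≤ t * Λ ^ ℓ :=
        ht.trans (le_mul_of_one_le_right (by linarith) (one_le_pow₀ hΛ1))
      obtain ⟨m, u, h⟩ := exists_isProfile_succ (ω := 1 / (2 * L)) (W := X) hG hcol hη
        (by linarith) (by linarith) hβ hβ4 hβη hj hD (by positivity)
        (by rw [div_lt_one (by positivity)]; linarith) ht' (ih (by omega)) (by
          have hΛ' : D / (β ^ j * (1 / (2 * L))) = Λ := by rw [hΛ]; field_simp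
          refine le_of_eq_of_le ?_ hX
          change t * Λ ^ ℓ * (D / (β ^ j * (1 / (2 * L)))) = t * Λ ^ (ℓ + 1)
          rw [hΛ', pow_succ Λ ℓ, mul_assoc])
      refine ⟨m, u, ?_⟩
      have e : (1 : ℝ) - ((ℓ + 1 : ℕ) : ℝ) * (1 / (2 * L)) =
          1 - ℓ * (1 / (2 * L)) - 1 / (2 * L) := by push_cast; ring
      rw [e]
      exact h
  obtain ⟨m, u, h⟩ := main L le_rfl W hW
  have hσL : (1 : ℝ) - L * (1 / (2 * L)) = 1 / 2 := by field_simp; norm_num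
  rw [hσL] at h
  set θ : ℝ := η * L / (8 * Fintype.card K) with hθ
  have hcardp : (Fintype.card (K × ι) : ℝ) = Fintype.card K * Fintype.card ι := by
    rw [Fintype.card_prod, Nat.cast_mul]
  have hlow : η / 4 * Fintype.card ι * L ≤ ∑ c, ∑ s, u c s := by
    refine le_trans ?_ h.sum_u
    -- The energy term costs at most `|ι| / η`, and `L ≥ 4 / η ^ 2` makes this at most half of the
    -- main term.
    have h1 : 0 ≤ 1 / η * ∑ s, m s ^ 2 :=
      mul_nonneg (by positivity) (Finset.sum_nonneg fun s _ => sq_nonneg _)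
    have h2 : 1 / η ≤ η / 4 * L := by
      rw [div_le_iff₀ (by positivity)] at hL
      rw [div_le_iff₀ hη]
      nlinarith
    have h3 := mul_le_mul_of_nonneg_right h2 (Nat.cast_nonneg (α := ℝ) (Fintype.card ι))
    linarith
  -- Markov's inequality for `u ≤ 1`; `θ` is half of the lower bound for the mean of `u`.
  have hup : ∑ c, ∑ s, u c s ≤ #{p : K × ι | θ ≤ u p.1 p.2} + θ * Fintype.card (K × ι) := by
    rw [← Fintype.sum_prod_type']
    calc ∑ p : K × ι, u p.1 p.2 ≤ ∑ p : K × ι, ((if θ ≤ u p.1 p.2 then 1 else 0) + θ) := by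
          refine Finset.sum_le_sum fun p _ => ?_
          split_ifs with hp
          · have := h.u_le_one p.1 p.2
            have : 0 ≤ θ := by positivity
            linarith
          · linarith
      _ = _ := by
          rw [Finset.sum_add_distrib, Finset.sum_boole, Finset.sum_const, Finset.card_univ,
            nsmul_eq_mul]
          ring
  have hθι : θ * Fintype.card (K × ι) = η / 8 * Fintype.card ι * L := by
    rw [hcardp, hθ]; field_simp
  have hcount : θ * Fintype.card (K × ι) ≤ #{p : K × ι | θ ≤ u p.1 p.2} := by linarith
  refine hcount.trans ?_
  refine Nat.cast_le.2 (Finset.card_le_card fun p hp => ?_)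
  rw [Finset.mem_filter] at hp ⊢
  refine ⟨hp.1, (h.deficit_u p.1 p.2).anti ?_⟩
  refine mul_le_mul_of_nonneg_right ?_ (Nat.cast_nonneg _)
  calc η ^ 3 * L / (512 * Fintype.card K) = 1 / 2 * (η ^ 2 / 32) * θ := by
        rw [hθ]; field_simp; norm_num
    _ ≤ _ := mul_le_mul_of_nonneg_left hp.2 (by positivity)

end Profile

/-! ### Choice of parameters -/

section Parameters

/-- The dominant term is `-j * log β`: here `j` is at most about `log D / β ^ 2`, and `-log β ≤ 1 /
β`. -/
theorem log_size_ratio_le {D β M R : ℝ} {j L : ℕ} (hD1 : 1 ≤ D) (hβ0 : 0 < β) (hβ4 : β ≤ 1 / 4)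
    (hM : Real.log D + Real.log (2 * R) + 1 ≤ M) (hL0 : (0 : ℝ) < L) (hLR : (L : ℝ) ≤ R)
    (hR : 1 ≤ R) (hj : (j : ℝ) ≤ Real.log D / β ^ 2 + 1) :
    Real.log (D * (2 * L) / β ^ j) ≤ 2 * M * (1 / β) ^ 3 := by
  have hlogD : 0 ≤ Real.log D := Real.log_nonneg hD1
  have hlog2r : 0 ≤ Real.log (2 * R) := Real.log_nonneg (by linarith)
  have hβlog : -Real.log β ≤ 1 / β := by
    have := Real.log_le_sub_one_of_pos (inv_pos.2 hβ0)
    rw [Real.log_inv] at this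
    rw [one_div]; linarith
  have hβinv : 1 ≤ 1 / β := by rw [one_le_div hβ0]; linarith
  have hjle : (j : ℝ) ≤ M * (1 / β) ^ 2 := by
    have e2 : 1 ≤ (1 / β) ^ 2 := one_le_pow₀ hβinv
    have e3 : Real.log D / β ^ 2 = Real.log D * (1 / β) ^ 2 := by
      rw [one_div, inv_pow, div_eq_mul_inv]
    have e4 : (Real.log D + 1) * (1 / β) ^ 2 ≤ M * (1 / β) ^ 2 :=
      mul_le_mul_of_nonneg_right (by linarith) (by positivity)
    rw [e3] at hj
    linarith
  rw [Real.log_div (by positivity) (by positivity), Real.log_mul (by positivity)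
    (by positivity), Real.log_pow]
  have e1 : Real.log (2 * L) ≤ Real.log (2 * R) :=
    Real.log_le_log (by positivity) (by linarith)
  have e2 : (j : ℝ) * -Real.log β ≤ M * (1 / β) ^ 2 * (1 / β) := by
    calc (j : ℝ) * -Real.log β ≤ j * (1 / β) :=
          mul_le_mul_of_nonneg_left hβlog (Nat.cast_nonneg _)
      _ ≤ _ := mul_le_mul_of_nonneg_right hjle (by positivity)
  have e3 : M ≤ M * (1 / β) ^ 3 := le_mul_of_one_le_right (by linarith) (one_le_pow₀ hβinv)
  linarith

-- Write `η = r ^ (-b)`, `β` of order `η ^ 2` and `L` of order `r ^ (1 - 8b)`. The logarithm of the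
-- size lost per level is of order at most `β ^ (-3) * log r`, that is `r ^ (6b) * log r`, so `L`
-- levels cost `r ^ (1 - 2b) * log r = o(r)`. The new proportion `η ^ 3 * L / r` is of order `r ^
-- (-11b)`, still polynomial.
set_option maxHeartbeats 800000 in
theorem eventually_parameters (k k₀ : ℕ) (hk₀ : 1 ≤ k₀) {a ε : ℝ} (ha : 0 < a) (hε : 0 < ε) :
    ∃ b : ℝ, 0 < b ∧ ∀ᶠ r : ℕ in atTop, ∃ (β : ℝ) (j L : ℕ), 0 < β ∧ β ≤ 1 / 4 ∧
      (2 * k + 1) * β ≤ ((r : ℝ) ^ (-b)) ^ 2 / 16 ∧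
      (1 - β ^ 2) ^ j * (2 * (r : ℝ) * k₀ ^ 2) ≤ 1 ∧ 1 ≤ 2 * (r : ℝ) * k₀ ^ 2 ∧
      (2 : ℝ) ≤ 2 ^ (ε / 2 * r) ∧ 4 / ((r : ℝ) ^ (-b)) ^ 2 ≤ L ∧
      (2 : ℝ) ^ (ε / 2 * r) * (2 * r * k₀ ^ 2 * (2 * L) / β ^ j) ^ L ≤ 2 ^ (ε * r) ∧
      (r : ℝ) ^ (-a) ≤ (r : ℝ) ^ (-b) * L / (8 * r) ∧
      (r : ℝ) ^ (-a) ≤ ((r : ℝ) ^ (-b)) ^ 3 * L / (512 * r) := by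
  -- `20 * b ≤ a` leaves a factor `r ^ (9 * b)` beyond the needed `11 * b` to absorb constants, and
  -- `20 * b ≤ 1` keeps `1 - 10 * b ≥ 1 / 2`.
  obtain ⟨b, hb0, hba, hb1⟩ : ∃ b : ℝ, 0 < b ∧ 20 * b ≤ a ∧ 20 * b ≤ 1 :=
    ⟨min a 1 / 20, by positivity, by linarith [min_le_left a 1], by linarith [min_le_right a 1]⟩
  refine ⟨b, hb0, ?_⟩
  set C : ℝ := 16 * (2 * k + 1) with hC
  have hC1 : 16 ≤ C := by rw [hC]; nlinarith [Nat.cast_nonneg (α := ℝ) k]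
  set c₀ : ℝ := Real.log (2 * k₀ ^ 2) + Real.log 2 + 1 with hc₀
  set C' : ℝ := 2 * C ^ 3 / (ε / 2 * Real.log 2) with hC'
  have hlog2 : 0 < Real.log 2 := Real.log_pos (by norm_num)
  have hC'0 : 0 < C' := by positivity
  have hrpow : ∀ (e z : ℝ), 0 < e → ∀ᶠ r : ℕ in atTop, z ≤ (r : ℝ) ^ e := fun e z he =>
    ((tendsto_rpow_atTop he).comp tendsto_natCast_atTop_atTop).eventually_ge_atTop z
  have hlog : ∀ᶠ r : ℕ in atTop, Real.log r ≤ 1 / (4 * C') * (r : ℝ) ^ (2 * b) := by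
    have h := (isLittleO_log_rpow_atTop (show 0 < 2 * b by positivity)).def
      (show 0 < 1 / (4 * C') by positivity)
    filter_upwards [tendsto_natCast_atTop_atTop.eventually h] with r hr
    rw [Real.norm_eq_abs, Real.norm_eq_abs,
      abs_of_nonneg (Real.rpow_nonneg (Nat.cast_nonneg r) _)] at hr
    exact (le_abs_self _).trans hr
  filter_upwards [hrpow (9 * b) 1024 (by positivity), hrpow (1 / 2) 8 (by norm_num),
    hrpow (2 * b) (2 * (C' * c₀)) (by positivity), hlog, eventually_ge_atTop 1,
    tendsto_natCast_atTop_atTop.eventually_ge_atTop (2 / ε)] with r h1 h2 h3 h4 h5 h6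
  have hr1 : (1 : ℝ) ≤ r := by exact_mod_cast h5
  have hr0 : (0 : ℝ) < r := by linarith
  have hk₀' : (1 : ℝ) ≤ k₀ := by exact_mod_cast hk₀
  set η : ℝ := (r : ℝ) ^ (-b) with hη
  have hη0 : 0 < η := Real.rpow_pos_of_pos hr0 _
  have hη1 : η ≤ 1 := Real.rpow_le_one_of_one_le_of_nonpos hr1 (by linarith)
  have hηpow : ∀ n : ℕ, η ^ n = (r : ℝ) ^ (-(b * n)) := fun n => by
    rw [hη, ← Real.rpow_natCast, ← Real.rpow_mul hr0.le, neg_mul]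
  set D : ℝ := 2 * (r : ℝ) * k₀ ^ 2 with hD
  have hD1 : 1 ≤ D := by rw [hD]; nlinarith [one_le_pow₀ hk₀' (n := 2)]
  set β : ℝ := η ^ 2 / C with hβ
  have hβ0 : 0 < β := by positivity
  have hβ4 : β ≤ 1 / 4 := by
    rw [hβ, div_le_iff₀ (by positivity)]
    nlinarith
  set j : ℕ := ⌈Real.log D / β ^ 2⌉₊ with hj
  set L : ℕ := ⌊(r : ℝ) ^ (1 - 8 * b)⌋₊ with hL
  have hR8 : (8 : ℝ) ≤ (r : ℝ) ^ (1 - 10 * b) :=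
    h2.trans (Real.rpow_le_rpow_of_exponent_le hr1 (by linarith))
  have hR8' : (8 : ℝ) ≤ (r : ℝ) ^ (1 - 8 * b) :=
    h2.trans (Real.rpow_le_rpow_of_exponent_le hr1 (by linarith))
  have hLle : (L : ℝ) ≤ (r : ℝ) ^ (1 - 8 * b) := Nat.floor_le (by linarith)
  have hLge : (r : ℝ) ^ (1 - 8 * b) / 2 ≤ L := by
    have := Nat.lt_floor_add_one ((r : ℝ) ^ (1 - 8 * b))
    rw [← hL] at this
    linarith
  have hL0 : (0 : ℝ) < L := by linarith
  have hLr : (L : ℝ) ≤ r := hLle.trans (by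
    calc (r : ℝ) ^ (1 - 8 * b) ≤ (r : ℝ) ^ (1 : ℝ) :=
          Real.rpow_le_rpow_of_exponent_le hr1 (by linarith)
      _ = r := Real.rpow_one _)
  have hηa : (r : ℝ) ^ (-a) ≤ η ^ 3 * L / (512 * r) := by
    rw [le_div_iff₀ (by positivity)]
    have e1 : η ^ 3 * ((r : ℝ) ^ (1 - 8 * b) / 2) ≤ η ^ 3 * L :=
      mul_le_mul_of_nonneg_left hLge (by positivity)
    have e2 : η ^ 3 * (r : ℝ) ^ (1 - 8 * b) = (r : ℝ) ^ (-(20 * b)) * (r : ℝ) ^ (9 * b) * r := by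
      rw [hηpow]
      nth_rewrite 5 [← Real.rpow_one (r : ℝ)]
      rw [← Real.rpow_add hr0, ← Real.rpow_add hr0, ← Real.rpow_add hr0]
      congr 1
      push_cast
      ring
    have e3 : (r : ℝ) ^ (-a) ≤ (r : ℝ) ^ (-(20 * b)) :=
      Real.rpow_le_rpow_of_exponent_le hr1 (by linarith)
    have e4 : 0 < (r : ℝ) ^ (-(20 * b)) := Real.rpow_pos_of_pos hr0 _
    have e5 : (r : ℝ) ^ (-(20 * b)) * 1024 * r ≤
        (r : ℝ) ^ (-(20 * b)) * (r : ℝ) ^ (9 * b) * r := by gcongr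
    have e6 : (r : ℝ) ^ (-a) * (1024 * r) ≤ (r : ℝ) ^ (-(20 * b)) * (1024 * r) := by gcongr
    linarith
  refine ⟨β, j, L, hβ0, hβ4, ?_, ?_, hD1, ?_, ?_, ?_, ?_, hηa⟩
  · rw [hβ, hC]
    apply le_of_eq
    field_simp
  · have e1 : 1 - β ^ 2 ≤ Real.exp (-β ^ 2) := by
      have := Real.add_one_le_exp (-β ^ 2); linarith
    have e2 : (1 - β ^ 2) ^ j ≤ Real.exp (-Real.log D) := by
      calc (1 - β ^ 2) ^ j ≤ Real.exp (-β ^ 2) ^ j :=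
            pow_le_pow_left₀ (by nlinarith) e1 _
        _ = Real.exp (j * (-β ^ 2)) := (Real.exp_nat_mul _ _).symm
        _ ≤ Real.exp (-Real.log D) := by
            refine Real.exp_le_exp.2 ?_
            have := Nat.le_ceil (Real.log D / β ^ 2)
            rw [← hj, div_le_iff₀ (by positivity)] at this
            linarith
    rw [Real.exp_neg, Real.exp_log (by linarith)] at e2
    calc (1 - β ^ 2) ^ j * D ≤ D⁻¹ * D := mul_le_mul_of_nonneg_right e2 (by linarith)
      _ = 1 := inv_mul_cancel₀ (by linarith)
  · have : (1 : ℝ) ≤ ε / 2 * r := by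
      rw [div_le_iff₀ hε] at h6; linarith
    calc (2 : ℝ) = 2 ^ (1 : ℝ) := (Real.rpow_one _).symm
      _ ≤ _ := Real.rpow_le_rpow_of_exponent_le (by norm_num) this
  · rw [div_le_iff₀ (by positivity)]
    have e1 : (r : ℝ) ^ (1 - 8 * b) / 2 * η ^ 2 ≤ L * η ^ 2 :=
      mul_le_mul_of_nonneg_right hLge (by positivity)
    have e2 : (r : ℝ) ^ (1 - 8 * b) * η ^ 2 = (r : ℝ) ^ (1 - 10 * b) := by
      rw [hηpow, ← Real.rpow_add hr0]
      congr 1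
      push_cast
      ring
    linarith
  · set M : ℝ := Real.log D + Real.log (2 * r) + 1 with hM
    have hlogD : 0 ≤ Real.log D := Real.log_nonneg hD1
    have hlog2r : 0 ≤ Real.log (2 * r) := Real.log_nonneg (by linarith)
    have hM1 : 1 ≤ M := by linarith
    have hMle : C' * M ≤ (r : ℝ) ^ (2 * b) := by
      have e1 : M = 2 * Real.log r + c₀ := by
        have : D = r * (2 * k₀ ^ 2) := by rw [hD]; ring
        rw [hM, hc₀, this, Real.log_mul hr0.ne' (by positivity),
          Real.log_mul (by norm_num) hr0.ne']
        ring
      have e2 := mul_le_mul_of_nonneg_left h4 hC'0.le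
      have e3 : C' * (1 / (4 * C') * (r : ℝ) ^ (2 * b)) = (r : ℝ) ^ (2 * b) / 4 := by
        field_simp
      rw [e1]
      linarith
    have hΛ0 : 0 < D * (2 * L) / β ^ j := by positivity
    have hlogΛ : Real.log (D * (2 * L) / β ^ j) ≤ 2 * M * (1 / β) ^ 3 :=
      log_size_ratio_le hD1 hβ0 hβ4 le_rfl hL0 hLr hr1
        (Nat.ceil_lt_add_one (show 0 ≤ Real.log D / β ^ 2 by positivity)).le
    have hβ3 : (1 / β) ^ 3 = C ^ 3 * (r : ℝ) ^ (6 * b) := by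
      have e1 : (1 / β) ^ 3 = C ^ 3 * (η ^ 6)⁻¹ := by
        rw [hβ, one_div, inv_div, div_pow, ← pow_mul, div_eq_mul_inv]
      rw [e1, hηpow, ← Real.rpow_neg hr0.le]
      congr 2
      push_cast
      ring
    have hfin : L * Real.log (D * (2 * L) / β ^ j) ≤ ε / 2 * r * Real.log 2 := by
      have e1 : L * Real.log (D * (2 * L) / β ^ j) ≤
          (r : ℝ) ^ (1 - 8 * b) * (2 * M * (C ^ 3 * (r : ℝ) ^ (6 * b))) := by
        calc L * Real.log (D * (2 * L) / β ^ j) ≤ L * (2 * M * (1 / β) ^ 3) :=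
              mul_le_mul_of_nonneg_left hlogΛ (Nat.cast_nonneg _)
          _ ≤ (r : ℝ) ^ (1 - 8 * b) * (2 * M * (1 / β) ^ 3) :=
              mul_le_mul_of_nonneg_right hLle (by positivity)
          _ = _ := by rw [hβ3]
      have e2 : (r : ℝ) ^ (1 - 8 * b) * (2 * M * (C ^ 3 * (r : ℝ) ^ (6 * b))) =
          ε / 2 * Real.log 2 * ((r : ℝ) ^ (1 - 8 * b) * (r : ℝ) ^ (6 * b) * (C' * M)) := by
        have e : ε / 2 * Real.log 2 * C' = 2 * C ^ 3 := by
          rw [hC']; exact mul_div_cancel₀ _ (by positivity)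
        linear_combination (-((r : ℝ) ^ (1 - 8 * b) * (r : ℝ) ^ (6 * b) * M)) * e
      have e3 : (r : ℝ) ^ (1 - 8 * b) * (r : ℝ) ^ (6 * b) * (C' * M) ≤
          (r : ℝ) ^ (1 - 8 * b) * (r : ℝ) ^ (6 * b) * (r : ℝ) ^ (2 * b) :=
        mul_le_mul_of_nonneg_left hMle (by positivity)
      have e4 : (r : ℝ) ^ (1 - 8 * b) * (r : ℝ) ^ (6 * b) * (r : ℝ) ^ (2 * b) = r := by
        rw [← Real.rpow_add hr0, ← Real.rpow_add hr0]
        convert Real.rpow_one (r : ℝ) using 2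
        ring
      rw [e4] at e3
      have e5 := mul_le_mul_of_nonneg_left e3 (show 0 ≤ ε / 2 * Real.log 2 by positivity)
      linarith
    have hpow : (D * (2 * L) / β ^ j) ^ L ≤ (2 : ℝ) ^ (ε / 2 * r) := by
      rw [← Real.log_le_log_iff (by positivity) (by positivity), Real.log_pow,
        Real.log_rpow (by norm_num)]
      exact hfin
    calc (2 : ℝ) ^ (ε / 2 * r) * (D * (2 * L) / β ^ j) ^ L
        ≤ 2 ^ (ε / 2 * r) * 2 ^ (ε / 2 * r) := mul_le_mul_of_nonneg_left hpow (by positivity)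
      _ = 2 ^ (ε * r) := by
          rw [← Real.rpow_add (by norm_num)]; congr 1; ring
  · refine hηa.trans ?_
    have e1 : η ^ 3 ≤ η := by
      calc η ^ 3 ≤ η ^ 1 := pow_le_pow_of_le_one hη0.le hη1 (by norm_num)
        _ = η := pow_one _
    have e2 : η ^ 3 * L ≤ η * L := mul_le_mul_of_nonneg_right e1 hL0.le
    exact div_le_div₀ (by positivity) e2 (by positivity) (by linarith)

end Parameters

/-! ### Induction on the number of colours -/

section Rich

open Classical in
/-- For any fixed `i`, a positive proportion (up to a factor `r ^ (-a)`) of suitable families of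
at most `i` colours has large deficit for `2 ^ i - 1` colours on any set of exponential size. -/
theorem eventually_card_deficit (k₀ : ℕ) (hk₀ : 1 ≤ k₀) (i : ℕ) :
    ∀ a : ℝ, 0 < a → ∀ ε : ℝ, 0 < ε → ∀ᶠ r : ℕ in atTop,
      ∃ (ι : Type) (_ : Fintype ι) (_ : Nonempty ι) (col : ι → Finset (Fin r)),
        (∀ s, #(col s) ≤ i) ∧
        ∀ (n : ℕ) (G : Fin r → SimpleGraph (Fin n)),
          (∀ u v, u ≠ v → ∃ c, (G c).Adj u v) → (∀ c A, ColorableOn G {c} k₀ A) →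
          ∀ W : Finset (Fin n), (2 : ℝ) ^ (ε * r) ≤ #W →
            (r : ℝ) ^ (-a) * Fintype.card ι ≤
              #{s | Deficit G (col s) (2 ^ i - 1) W ((r : ℝ) ^ (-a) * #W)} := by
  induction i with
  | zero =>
    intro a ha ε hε
    filter_upwards [eventually_ge_atTop 1] with r hr
    have hr1 : (r : ℝ) ^ (-a) ≤ 1 :=
      Real.rpow_le_one_of_one_le_of_nonpos (by exact_mod_cast hr) (by linarith)
    refine ⟨Unit, inferInstance, inferInstance, fun _ => ∅, by simp, fun n G _ _ W _ => ?_⟩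
    -- Only the empty set is colourable with `0` colours, so all of `W` has to be deleted.
    have hdef : Deficit G ∅ (2 ^ 0 - 1) W ((r : ℝ) ^ (-a) * #W) := by
      rintro A - ⟨f, hf, -⟩
      have hA : A = ∅ := by
        simpa using hf
      rw [hA, Finset.card_empty, Nat.cast_zero, zero_add]
      exact mul_le_of_le_one_left (Nat.cast_nonneg _) hr1
    rw [Finset.filter_true_of_mem fun _ _ => hdef]
    simpa using hr1
  | succ i ih =>
    intro a ha ε hε
    -- Each step worsens both exponents, so the induction hypothesis is applied with the smaller `b`
    -- and `ε / 2`; this is why it is stated for all `a` and `ε`.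
    obtain ⟨b, hb, hpar⟩ := eventually_parameters (2 ^ i - 1) k₀ hk₀ ha hε
    filter_upwards [hpar, ih b hb (ε / 2) (by positivity), eventually_ge_atTop 1]
      with r ⟨β, j, L, hβ, hβ4, hβη, hj, hD, ht, hL, hsize, ha1, ha2⟩ ⟨ι, _, _, col, hcol, hprof⟩ hr
    have : Nonempty (Fin r) := ⟨⟨0, hr⟩⟩
    refine ⟨Fin r × ι, inferInstance, inferInstance, fun p => insert p.1 (col p.2), fun p =>
      (Finset.card_insert_le _ _).trans (Nat.succ_le_succ (hcol p.2)), fun n G hG hGc W hW => ?_⟩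
    have hη : 0 < (r : ℝ) ^ (-b) := Real.rpow_pos_of_pos (by exact_mod_cast hr) _
    have h := le_card_deficit_insert (K := Fin r) (col := col) (k := 2 ^ i - 1) (L := L) (W := W)
      hG hGc hη hβ hβ4 hβη (by rw [Fintype.card_fin]; exact hj)
      (by rw [Fintype.card_fin]; exact hD) ht hL (hprof n G hG hGc)
      (by rw [Fintype.card_fin]; exact hsize.trans hW)
    rw [Fintype.card_fin] at h
    have hk : 2 * (2 ^ i - 1) + 1 = 2 ^ (i + 1) - 1 := by
      have := Nat.one_le_two_pow (n := i)
      rw [pow_succ]; omega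
    rw [hk] at h
    refine (mul_le_mul_of_nonneg_right ha1 (Nat.cast_nonneg _)).trans (h.trans ?_)
    refine Nat.cast_le.2 (Finset.card_le_card fun p hp => ?_)
    rw [Finset.mem_filter] at hp ⊢
    exact ⟨hp.1, hp.2.anti (mul_le_mul_of_nonneg_right ha2 (Nat.cast_nonneg _))⟩

/-- Eventually, any `r`-coloured complete graph on at least `2 ^ (ε r)` vertices contains `i`
colours whose union is not `2 ^ i - 1`-colourable. -/
theorem eventually_exists_not_colorable (i : ℕ) (hi : 1 ≤ i) {ε : ℝ} (hε : 0 < ε) :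
    ∀ᶠ r : ℕ in atTop, ∀ (n : ℕ) (G : Fin r → SimpleGraph (Fin n)),
      (∀ u v, u ≠ v → ∃ c, (G c).Adj u v) → (2 : ℝ) ^ (ε * r) ≤ n →
      ∃ S : Finset (Fin r), #S ≤ i ∧ ¬ (⨆ c ∈ S, G c).Colorable (2 ^ i - 1) := by
  classical
  have h2 : 2 ≤ 2 ^ i := by
    calc 2 = 2 ^ 1 := rfl
      _ ≤ 2 ^ i := Nat.pow_le_pow_right (by norm_num) hi
  have hconv : ∀ {r n : ℕ} (G : Fin r → SimpleGraph (Fin n)) (S : Finset (Fin r)) (k : ℕ),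
      (⨆ c ∈ S, G c).Colorable k → ∀ A, ColorableOn G S k A := by
    rintro r n G S k ⟨C⟩ A
    refine ⟨fun v => C v, ?_, fun u _ v _ c hc hadj he => ?_⟩
    · calc #(A.image fun v => ((C v : Fin k) : ℕ)) ≤ #(Finset.range k) :=
            Finset.card_le_card fun x hx => by
              obtain ⟨v, -, rfl⟩ := Finset.mem_image.1 hx
              exact Finset.mem_range.2 (C v).2
        _ = k := Finset.card_range k
    · refine C.valid (v := u) (w := v) ?_ (Fin.ext he)
      simp only [SimpleGraph.iSup_adj]
      exact ⟨c, hc, hadj⟩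
  filter_upwards [eventually_card_deficit (2 ^ i - 1) (by omega) i 1 one_pos ε hε,
    eventually_ge_atTop 1] with r ⟨ι, _, _, col, hcol, h⟩ hr n G hG hn
  by_contra hno
  push Not at hno
  have hr0 : 0 < (r : ℝ) ^ (-1 : ℝ) := Real.rpow_pos_of_pos (by exact_mod_cast hr) _
  have hn0 : (0 : ℝ) < n := lt_of_lt_of_le (by positivity) hn
  -- The assumption to be refuted, applied to single colours, supplies the bound `k₀ = 2 ^ i - 1` on
  -- each colour class; applied to a family of positive deficit, it gives the contradiction.
  have hcard := h n G hG (fun c A => hconv G {c} _ (hno {c} (by simpa using hi)) A) Finset.univ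
    (by simpa using hn)
  have hpos : 0 < #{s | Deficit G (col s) (2 ^ i - 1) Finset.univ
      ((r : ℝ) ^ (-1 : ℝ) * #(Finset.univ : Finset (Fin n)))} := by
    have : (0 : ℝ) < (r : ℝ) ^ (-1 : ℝ) * Fintype.card ι :=
      mul_pos hr0 (by exact_mod_cast Fintype.card_pos)
    exact_mod_cast this.trans_le hcard
  obtain ⟨s, hs⟩ := Finset.card_pos.1 hpos
  have hdef := (Finset.mem_filter.1 hs).2 Finset.univ subset_rfl
    (hconv G (col s) _ (hno (col s) (hcol s)) _)
  rw [Finset.card_univ, Fintype.card_fin] at hdef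
  have : 0 < (r : ℝ) ^ (-1 : ℝ) * n := mul_pos hr0 hn0
  linarith

end Rich

/-! ### Bounds on the chromatic Ramsey number -/

section ChromaticRamsey

/-- If few colours span a graph that is not `k`-colourable, then they contain a subgraph of
chromatic number exactly `k + 1`. -/
theorem exists_subgraph_of_not_colorable {n r k : ℕ}
    (c : SimpleGraph.TopEdgeLabeling (Fin n) (Fin r)) (S : Finset (Fin r))
    (h : ¬ (⨆ i ∈ S, c.labelGraph i).Colorable k) :
    ∃ H : (⊤ : SimpleGraph (Fin n)).Subgraph,
      H.coe.chromaticNumber = ((k + 1 : ℕ) : ℕ∞) ∧ numColours c H ≤ #S := by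
  obtain ⟨T, hT⟩ := exists_induce_chromaticNumber_eq _ _ h
  let H : (⊤ : SimpleGraph (Fin n)).Subgraph :=
    { verts := T
      Adj := fun a b => a ∈ T ∧ b ∈ T ∧ (⨆ i ∈ S, c.labelGraph i).Adj a b
      adj_sub := fun h => h.2.2.ne
      edge_vert := fun h => h.1
      symm := ⟨fun _ _ h => ⟨h.2.1, h.1, h.2.2.symm⟩⟩ }
  have hH : H.coe = (⨆ i ∈ S, c.labelGraph i).induce T := by
    ext a b
    exact ⟨fun h => h.2.2, fun h => ⟨a.2, b.2, h⟩⟩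
  refine ⟨H, by rw [hH]; exact hT, ?_⟩
  have hsub : c '' {e | (e : Sym2 (Fin n)) ∈ H.edgeSet} ⊆ (S : Set (Fin r)) := by
    rintro _ ⟨⟨e, he⟩, hmem, rfl⟩
    induction e using Sym2.ind with
    | _ a b =>
      have hab : (⨆ i ∈ S, c.labelGraph i).Adj a b := (SimpleGraph.Subgraph.mem_edgeSet.1 hmem).2.2
      simp only [SimpleGraph.iSup_adj] at hab
      obtain ⟨i, hi, hab⟩ := hab
      obtain ⟨_, h⟩ := (SimpleGraph.TopEdgeLabeling.labelGraph_adj a b).1 hab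
      have h' : c ⟨s(a, b), he⟩ = i := h
      rw [h']
      exact hi
  calc numColours c H ≤ (S : Set (Fin r)).ncard := Set.ncard_le_ncard hsub
    _ = #S := Set.ncard_coe_finset S

theorem exists_labelGraph_adj {n r : ℕ} (c : SimpleGraph.TopEdgeLabeling (Fin n) (Fin r))
    (u v : Fin n) (huv : u ≠ v) : ∃ i, (c.labelGraph i).Adj u v :=
  ⟨c.get u v huv, (SimpleGraph.TopEdgeLabeling.labelGraph_adj u v).2 ⟨huv, rfl⟩⟩

/-- Classical upper bound: if each colour class is `k`-colourable then there are at most `k ^ r`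
vertices. -/
theorem forcesChromatic_pow_add_one (r k q : ℕ) (hq : 2 ≤ q) :
    ForcesChromatic r (k + 1) q (k ^ r + 1) := by
  intro c
  by_contra hno
  have hcol : ∀ i : Fin r, (c.labelGraph i).Colorable k := by
    intro i
    by_contra hi
    obtain ⟨H, h1, h2⟩ := exists_subgraph_of_not_colorable (k := k) c {i} (by simpa using hi)
    rw [Finset.card_singleton] at h2
    exact hno ⟨H, h1, by omega⟩
  have C := fun i => (hcol i).some
  have hcard : Fintype.card (Fin r → Fin k) < Fintype.card (Fin (k ^ r + 1)) := by simp
  obtain ⟨u, v, huv, he⟩ := Fintype.exists_ne_map_eq_of_card_lt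
    (fun (v : Fin (k ^ r + 1)) (i : Fin r) => C i v) hcard
  obtain ⟨i, hi⟩ := exists_labelGraph_adj c u v huv
  exact (C i).valid hi (congrFun he i)

/-- Colouring each pair of binary words by a coordinate in which they differ. -/
theorem not_forcesChromatic_two_pow {r p q : ℕ} (hpq : 2 ^ (q - 1) < p) {n : ℕ}
    (hn : n ≤ 2 ^ r) : ¬ ForcesChromatic r p q n := by
  classical
  have hcard : Fintype.card (Fin n) ≤ Fintype.card (Fin r → Bool) := by simpa using hn
  obtain ⟨φ⟩ := Function.Embedding.nonempty_of_card_le hcard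
  have hdiff : ∀ e : (⊤ : SimpleGraph (Fin n)).edgeSet,
      ∃ i : Fin r, ∀ x y, (e : Sym2 (Fin n)) = s(x, y) → φ x i ≠ φ y i := by
    rintro ⟨e, he⟩
    induction e using Sym2.ind with
    | _ a b =>
      have hab : a ≠ b := he
      obtain ⟨i, hi⟩ := Function.ne_iff.1 (φ.injective.ne hab)
      refine ⟨i, fun x y hxy => ?_⟩
      rcases Sym2.eq_iff.1 hxy with ⟨rfl, rfl⟩ | ⟨rfl, rfl⟩
      · exact hi
      · exact hi.symm
  choose c hc using hdiff
  intro h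
  obtain ⟨H, hH, hle⟩ := h c
  set T : Set (Fin r) := c '' {e | (e : Sym2 (Fin n)) ∈ H.edgeSet} with hT
  -- Words restricted to the colours occurring in `H`: the ends of an edge differ in the coordinate
  -- that is its colour.
  have hcol : H.coe.Coloring (T → Bool) := SimpleGraph.Coloring.mk (fun v i => φ v i) (by
    intro a b hab heq
    have hadj : H.Adj a b := hab
    have hne : (a : Fin n) ≠ b := hadj.ne
    let e : (⊤ : SimpleGraph (Fin n)).edgeSet := ⟨s((a : Fin n), b), hne⟩
    exact hc e a b rfl (congrFun heq ⟨c e, e, hadj, rfl⟩))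
  have h1 : H.coe.Colorable (2 ^ (q - 1)) := by
    have : Fintype.card (T → Bool) ≤ 2 ^ (q - 1) := by
      rw [Fintype.card_fun, Fintype.card_bool, ← Nat.card_eq_fintype_card]
      exact Nat.pow_le_pow_right (by norm_num) hle
    exact hcol.colorable.mono this
  have h2 := h1.chromaticNumber_le
  rw [hH] at h2
  have : p ≤ 2 ^ (q - 1) := by exact_mod_cast h2
  omega

/-- At most `k ≤ q - 1` colours have a union that is not `(2 ^ k - 1)`-colourable, hence not `(p -
1)`-colourable, and chromatic number exactly `p` is reached on an induced subgraph of it. -/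
theorem eventually_chromaticRamsey_le {p q k : ℕ} (hk : 1 ≤ k) (hp : 1 ≤ p) (hpk : p ≤ 2 ^ k)
    (hkq : k < q) {ε : ℝ} (hε : 0 < ε) :
    ∀ᶠ r : ℕ in atTop, (chromaticRamsey r p q : ℝ) ≤ 2 ^ (ε * r) + 1 := by
  filter_upwards [eventually_exists_not_colorable k hk hε] with r hr
  have hforce : ForcesChromatic r p q ⌈(2 : ℝ) ^ (ε * r)⌉₊ := by
    intro c
    obtain ⟨S, hS, hSc⟩ := hr _ (fun i => c.labelGraph i) (exists_labelGraph_adj c)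
      (Nat.le_ceil _)
    obtain ⟨H, h1, h2⟩ := exists_subgraph_of_not_colorable (k := p - 1) c S
      fun h => hSc (h.mono (by omega))
    exact ⟨H, by rw [h1, Nat.sub_add_cancel hp], by omega⟩
  have h1 : chromaticRamsey r p q ≤ ⌈(2 : ℝ) ^ (ε * r)⌉₊ := Nat.sInf_le hforce
  calc (chromaticRamsey r p q : ℝ) ≤ ⌈(2 : ℝ) ^ (ε * r)⌉₊ := by exact_mod_cast h1
    _ ≤ _ := (Nat.ceil_lt_add_one (by positivity)).le

theorem one_le_chromaticRamsey {r p q : ℕ} (hp : 2 ≤ p) (hq : 2 ≤ q) :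
    1 ≤ chromaticRamsey r p q := by
  by_contra h
  have h0 : chromaticRamsey r p q = 0 := by omega
  have hmem : ForcesChromatic r p q (chromaticRamsey r p q) :=
    (chromaticRamsey_isLeast r p q hp hq).1
  rw [h0] at hmem
  obtain ⟨H, hH, -⟩ := hmem (fun e => (e.1.out.1).elim0)
  have hcol : H.coe.Colorable 0 :=
    ⟨SimpleGraph.Coloring.mk (fun v => v.1.elim0) (fun {v} => v.1.elim0)⟩
  have := hcol.chromaticNumber_le
  rw [hH] at this
  have : p ≤ 0 := by exact_mod_cast this
  omega

theorem cast_eq_two_rpow_logb {m : ℕ} (hm : 1 ≤ m) : (m : ℝ) = 2 ^ Real.logb 2 m :=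
  (Real.rpow_logb (by norm_num) (by norm_num) (by exact_mod_cast hm)).symm

theorem isSubexponential_chromaticRamsey {p q k : ℕ} (hk : 1 ≤ k) (hp : 2 ≤ p)
    (hpk : p ≤ 2 ^ k) (hkq : k < q) : IsSubexponential (fun r => chromaticRamsey r p q) := by
  have hF : ∀ r, 1 ≤ chromaticRamsey r p q := fun r => one_le_chromaticRamsey hp (by omega)
  refine ⟨fun r => Real.logb 2 (chromaticRamsey r p q), ?_,
    Eventually.of_forall fun r => cast_eq_two_rpow_logb (hF r)⟩
  rw [isLittleO_iff]
  intro ε hε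
  filter_upwards [eventually_chromaticRamsey_le hk (by omega) hpk hkq (half_pos hε),
    tendsto_natCast_atTop_atTop.eventually_ge_atTop (2 / ε)] with r hr hrε
  have hF1 : (1 : ℝ) ≤ chromaticRamsey r p q := by exact_mod_cast hF r
  have hεr : 1 ≤ ε / 2 * r := by
    rw [div_le_iff₀ hε] at hrε; linarith
  rw [Real.norm_of_nonneg (Real.logb_nonneg (by norm_num) hF1),
    Real.norm_of_nonneg (Nat.cast_nonneg r)]
  rw [Real.logb_le_iff_le_rpow (by norm_num) (by linarith)]
  have h1 : (1 : ℝ) ≤ 2 ^ (ε / 2 * r) := Real.one_le_rpow (by norm_num) (by linarith)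
  -- Half of the exponent is kept in reserve to absorb the `+ 1` from rounding.
  have h2 : (2 : ℝ) ≤ 2 ^ (ε / 2 * r) := by
    calc (2 : ℝ) = 2 ^ (1 : ℝ) := (Real.rpow_one _).symm
      _ ≤ _ := Real.rpow_le_rpow_of_exponent_le (by norm_num) hεr
  calc (chromaticRamsey r p q : ℝ) ≤ 2 ^ (ε / 2 * r) + 1 := hr
    _ ≤ 2 ^ (ε / 2 * r) * 2 ^ (ε / 2 * r) := by nlinarith
    _ = 2 ^ (ε * r) := by rw [← Real.rpow_add (by norm_num)]; congr 1; ring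

theorem isExponential_chromaticRamsey {p q : ℕ} (hp : 2 ≤ p) (hq : 2 ≤ q)
    (hpq : 2 ^ (q - 1) < p) : IsExponential (fun r => chromaticRamsey r p q) := by
  have hF : ∀ r, 1 ≤ chromaticRamsey r p q := fun r => one_le_chromaticRamsey hp hq
  have hlow : ∀ r, 2 ^ r ≤ chromaticRamsey r p q := by
    intro r
    by_contra h
    exact not_forcesChromatic_two_pow hpq (not_le.1 h).le
      (chromaticRamsey_isLeast r p q hp hq).1
  have hup : ∀ r, chromaticRamsey r p q ≤ p ^ (r + 1) := by
    intro r
    have h1 : chromaticRamsey r p q ≤ (p - 1) ^ r + 1 := by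
      refine Nat.sInf_le ?_
      have := forcesChromatic_pow_add_one r (p - 1) q hq
      rwa [Nat.sub_add_cancel (by omega)] at this
    have h2 : (p - 1) ^ r ≤ p ^ r := Nat.pow_le_pow_left (by omega) r
    have h3 : 1 ≤ p ^ r := Nat.one_le_pow _ _ (by omega)
    calc chromaticRamsey r p q ≤ p ^ r * 2 := by omega
      _ ≤ p ^ r * p := Nat.mul_le_mul_left _ hp
      _ = p ^ (r + 1) := (pow_succ p r).symm
  refine ⟨fun r => Real.logb 2 (chromaticRamsey r p q), ⟨?_, ?_⟩,
    Eventually.of_forall fun r => cast_eq_two_rpow_logb (hF r)⟩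
  · refine IsBigO.of_bound (2 * Real.logb 2 p) ?_
    filter_upwards [eventually_ge_atTop 1] with r hr
    have hF1 : (1 : ℝ) ≤ chromaticRamsey r p q := by exact_mod_cast hF r
    have hr1 : (1 : ℝ) ≤ r := by exact_mod_cast hr
    have hlogp : 0 ≤ Real.logb 2 p :=
      Real.logb_nonneg (by norm_num) (by exact_mod_cast (by omega : 1 ≤ p))
    rw [Real.norm_of_nonneg (Real.logb_nonneg (by norm_num) hF1),
      Real.norm_of_nonneg (Nat.cast_nonneg r)]
    calc Real.logb 2 (chromaticRamsey r p q) ≤ Real.logb 2 ((p : ℝ) ^ (r + 1)) :=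
          Real.logb_le_logb_of_le (by norm_num) (by linarith) (by exact_mod_cast hup r)
      _ = (r + 1 : ℕ) * Real.logb 2 p := Real.logb_pow _ _ _
      _ ≤ 2 * Real.logb 2 p * r := by push_cast; nlinarith
  · refine IsBigO.of_bound 1 (Eventually.of_forall fun r => ?_)
    have hF1 : (1 : ℝ) ≤ chromaticRamsey r p q := by exact_mod_cast hF r
    rw [Real.norm_of_nonneg (Real.logb_nonneg (by norm_num) hF1),
      Real.norm_of_nonneg (Nat.cast_nonneg r), one_mul,
      Real.le_logb_iff_rpow_le (by norm_num) (by linarith), Real.rpow_natCast]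
    exact_mod_cast hlow r

theorem IsSubexponential.not_isExponential {F : ℕ → ℕ} (h : IsSubexponential F) :
    ¬ IsExponential F := by
  rintro ⟨g, hg, hFg⟩
  obtain ⟨g', hg', hFg'⟩ := h
  have heq : g' =ᶠ[atTop] g := by
    filter_upwards [hFg, hFg'] with r h1 h2
    have h3 : (2 : ℝ) ^ g' r = 2 ^ g r := by rw [← h1, ← h2]
    have h4 := congrArg (Real.logb 2) h3
    rwa [Real.logb_rpow (by norm_num) (by norm_num),
      Real.logb_rpow (by norm_num) (by norm_num)] at h4
  have hself : (fun r : ℕ => (r : ℝ)) =o[atTop] (fun r : ℕ => (r : ℝ)) :=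
    hg.2.trans_isLittleO (hg'.congr' heq EventuallyEq.rfl)
  have hev := isLittleO_irrefl' (f' := fun r : ℕ => (r : ℝ)) (l := atTop)
    ((eventually_ge_atTop 1).mono fun r hr => by
      rw [norm_ne_zero_iff]
      exact_mod_cast (by omega : r ≠ 0)).frequently
  exact hev hself

end ChromaticRamsey

theorem theorem1 :
    (∀ q : ℕ, 2 ≤ q →
      IsSubexponential (fun r => chromaticRamsey r (2 ^ q) (q + 1))) ∧
    (∀ p q : ℕ, 3 ≤ p → 2 ≤ q → q ≤ p.choose 2 →
      (IsExponential (fun r => chromaticRamsey r p q) ↔ q ≤ Nat.clog 2 p) ∧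
      (Nat.clog 2 p < q → IsSubexponential (fun r => chromaticRamsey r p q))) := by
  refine ⟨fun q hq => isSubexponential_chromaticRamsey (k := q) (by omega) ?_ le_rfl
    (Nat.lt_succ_self q), fun p q hp hq _ => ?_⟩
  · calc 2 = 2 ^ 1 := rfl
      _ ≤ 2 ^ q := Nat.pow_le_pow_right (by norm_num) (by omega)
  · have hsub : Nat.clog 2 p < q → IsSubexponential (fun r => chromaticRamsey r p q) := fun h =>
      isSubexponential_chromaticRamsey (k := Nat.clog 2 p)
        (Nat.clog_pos (by norm_num) (by omega)) (by omega) (Nat.le_pow_clog (by norm_num) p) h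
    refine ⟨⟨fun h => ?_, fun h => ?_⟩, hsub⟩
    · by_contra hlt
      exact (hsub (not_le.1 hlt)).not_isExponential h
    · refine isExponential_chromaticRamsey (by omega) hq ?_
      -- The two regimes meet without a gap: for `q ≥ 1`, `q ≤ Nat.clog 2 p` is equivalent to `2 ^
      -- (q - 1) < p`.
      exact (Nat.lt_clog_iff_pow_lt (by norm_num)).1 (by omega)
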